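/- **Setting.** Let $\mathbb F_q\subseteq\mathbb F_{q^m}$ be finite fields and let $\mathbf n=(n_1,\dots,n_\ell)$ be a composition of $n$ (all $n_i>0$, $\sum_i n_i=n$); vectors of $\mathbb F_{q^m}^n$ are divided into $\ell$ blocks of lengths $n_1,\dots,n_\ell$. A *generalized linearized Reed–Solomon (GLRS) code* with respect to an automorphism $\theta$ of $\mathbb F_{q^m}/\mathbb F_q$ and the derivation $\delta=\gamma(\mathrm{Id}-\theta)$ is a code $$\{(v_1c^{(1)}(f)\mid\dots\mid v_\ell c^{(\ell)}(f)) : f=\textstyle\sum_{t<k}f_tx^t\in\mathbb F_{q^m}[x;\theta,\delta]_{<k}\},\qquad c^{(i)}(f)_j=\sum_t f_t\,\mathcal D_{a_i}^t(\beta^{(i)}_j),\quad \mathcal D_a(b)=\theta(b)a+\delta(b),$$ where $a_1,\dots,a_\ell$ represent distinct nontrivial $(\theta,\delta)$-conjugacy classes ($a,b$ are conjugate if $b=\theta(c)ac^{-1}+\delta(c)c^{-1}$ for some $c\ne0$; the class of $\gamma$ is the trivial one), the entries of each block $\beta^{(i)}$ are $\mathbb F_q$-linearly independent, and all $v_i\in\mathbb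 F_{q^m}$ are nonzero. Here $\theta=\mathrm{Id}$, so that $\delta=0$. The *square code* $\mathcal C\star\mathcal C$ of a linear code $\mathcal C$ is the linear span of all elementwise products of two codewords. **Theorem (Square-Code Distinguisher).** There are a constant $A$ and one algorithm (a fixed register-machine program, the same for all fields and parameters, that uses field operations and zero tests in $\mathbb F_{q^m}$, together with index registers that are reset, incremented, copied and compared) such that the following holds for all $\mathbb F_q\subseteq\mathbb F_{q^m}$, all $n,k$ with $2<k\le n/2$, and all compositions $\mathbf n$ of $n$ with $\ell$ parts. 1. Given $n,k,\ell$ and any generator matrix $G\in\mathbb F_{q^m}^{k\times n}$ of any $k$-dimensional code $\mathcal C\subseteq\mathbb F_{q^m}^n$, the algorithm stops after at most $A\,n^5$ steps (counting all field operations, tests and index operations), it outputs $\dim(\mathcal C\star\mathcal C)$, and it declares $\mathcal C$ to be a GLRS code if and only if $\dim(\mathcal C\star\mathcal C)=\min(\ell,2k-1)$. 2. If $\mathcal C$ is a GLRS code with respect to $\theta=\mathrm{Id}$ and $\mathbf n$, then the algorithm always declares it to be one. 3. If $\mathcal C$ is chosen uniformly at random among the $k$-dimensional subspaces of $\mathbb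 F_{q^m}^n$, then the probability that the algorithm declares $\mathcal C$, given by some generator matrix, to be a GLRS code tends to $0$ as $\max(k,q^m)\to\infty$, uniformly in all other parameters: for every $\varepsilon>0$ there is a $K$, depending only on $\varepsilon$, such that this probability is at most $\varepsilon$ whenever $2<k\le n/2$ and $k\ge K$ or $q^m\ge K$. -/

import Mathlib

/-! ### Skew evaluation and generalized linearized Reed-Solomon codes -/

section Codes

variable {Fq F : Type*} [Field Fq] [Field F] [Algebra Fq F]

/-- The inner derivation `γ (Id - θ)` attached to an automorphism `θ`. -/
def innerDer (θ : F ≃ₐ[Fq] F) (γ b : F) : F := γ * (b - θ b)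

/-- The operator `b ↦ θ(b) a + δ(b)` with `δ = γ (Id - θ)`. -/
def skewOp (θ : F ≃ₐ[Fq] F) (γ a b : F) : F := θ b * a + innerDer θ γ b

/-- `(θ, δ)`-conjugacy for `δ = γ (Id - θ)`: `b = θ(c) a c⁻¹ + δ(c) c⁻¹` for some `c ≠ 0`. -/
def SkewConj (θ : F ≃ₐ[Fq] F) (γ a b : F) : Prop :=
  ∃ c : F, c ≠ 0 ∧ θ c * a * c⁻¹ + innerDer θ γ c * c⁻¹ = b

/-- Generalized operator evaluation, at `b` with evaluation parameter `a`, of the skew polynomial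
`∑ i, f i * x ^ i` of degree less than `k`, given by its coefficients. -/
def skewEval (θ : F ≃ₐ[Fq] F) (γ : F) {k : ℕ} (f : Fin k → F) (a b : F) : F :=
  ∑ i : Fin k, f i * (skewOp θ γ a)^[(i : ℕ)] b

/-- The set of words `(v_1 c⁽¹⁾(f) | ... | v_ℓ c⁽ˡ⁾(f))`, where `f` runs over the skew polynomials
of degree less than `k` and `c⁽ⁱ⁾(f)` consists of the evaluations of `f` at the entries of the
`i`-th block of `β` with evaluation parameter `a i`. The position `j` lies in block `blk.index j`. -/
def glrsCode (θ : F ≃ₐ[Fq] F) (γ : F) {n : ℕ} (blk : Composition n) (k : ℕ)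
    (β : Fin n → F) (a v : Fin blk.length → F) : Submodule F (Fin n → F) where
  carrier := {c | ∃ f : Fin k → F,
    c = fun j => v (blk.index j) * skewEval θ γ f (a (blk.index j)) (β j)}
  zero_mem' := ⟨0, by funext j; simp [skewEval]⟩
  add_mem' := by
    rintro _ _ ⟨f, rfl⟩ ⟨g, rfl⟩
    refine ⟨f + g, ?_⟩
    funext j
    simp [skewEval, add_mul, Finset.sum_add_distrib, mul_add]
  smul_mem' := by
    rintro r _ ⟨f, rfl⟩
    refine ⟨r • f, ?_⟩
    funext j
    simp only [Pi.smul_apply, smul_eq_mul, skewEval, mul_assoc, ← Finset.mul_sum]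
    ring

/-- `C` is a generalized linearized Reed-Solomon code, with respect to the automorphism `θ`, the
derivation `γ (Id - θ)` and the composition `blk` of `n`, built from skew polynomials of degree
less than `k`: the evaluation parameters represent distinct nontrivial conjugacy classes (the
trivial one being that of `γ`), each block of `β` is linearly independent over `Fq`, and the block
multipliers are nonzero. -/
def IsGLRS (θ : F ≃ₐ[Fq] F) (γ : F) {n : ℕ} (blk : Composition n) (k : ℕ)
    (C : Submodule F (Fin n → F)) : Prop :=
  ∃ (β : Fin n → F) (a v : Fin blk.length → F),
    (∀ i j, i ≠ j → ¬ SkewConj θ γ (a i) (a j)) ∧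
    (∀ i, ¬ SkewConj θ γ γ (a i)) ∧
    (∀ i, LinearIndependent Fq (fun j : Fin (blk.blocksFun i) => β (blk.embedding i j))) ∧
    (∀ i, v i ≠ 0) ∧
    C = glrsCode θ γ blk k β a v

/-- The code generated by the rows of a matrix. -/
def rowCode {k n : ℕ} (G : Matrix (Fin k) (Fin n) F) : Submodule F (Fin n → F) :=
  Submodule.span F (Set.range G.row)

/-- `G` is a generator matrix of the `k`-dimensional code `C`. -/
def IsGeneratorMatrix {k n : ℕ} (G : Matrix (Fin k) (Fin n) F)
    (C : Submodule F (Fin n → F)) : Prop :=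
  rowCode G = C ∧ Module.finrank F C = k

/-- The square code: the span of all elementwise products of two codewords. -/
def squareCode {n : ℕ} (C : Submodule F (Fin n → F)) : Submodule F (Fin n → F) :=
  Submodule.span F {x | ∃ c ∈ C, ∃ d ∈ C, x = fun j => c j * d j}

/-- The probability that a code chosen uniformly at random among the `k`-dimensional subspaces of
`F ^ n` (`F` finite) belongs to `E`. -/
noncomputable def randomCodeProb (k n : ℕ) (E : Set (Submodule F (Fin n → F))) : ℝ :=
  (Set.ncard {C : Submodule F (Fin n → F) | Module.finrank F C = k ∧ C ∈ E} : ℝ) /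
    (Set.ncard {C : Submodule F (Fin n → F) | Module.finrank F C = k} : ℝ)

end Codes

/-! ### Programs over a field

A register machine with index registers, which hold natural numbers, and two-dimensional arrays of
field elements, whose entries are addressed through index registers. A program is a fixed finite
text that refers neither to the field nor to the input length. The only loops repeat a block as
often as the value of a register says on entry, so that every program terminates. Every
instruction, test and loop iteration costs one step, whether it acts on field elements or on index
registers; index registers can only be reset, incremented, copied and compared. -/

/-- A field memory cell: entry number (register `row`, register `col`) of the array `arr`. -/
structure Cell where
  arr : ℕ
  row : ℕ
  col : ℕ

/-- Program texts. Natural numbers are names of index registers. -/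
inductive Program : Type
  /-- run one program, then another -/
  | seq : Program → Program → Program
  /-- register := 0 -/
  | reset : ℕ → Program
  /-- register := register + 1 -/
  | incr : ℕ → Program
  /-- first register := second register -/
  | copy : ℕ → ℕ → Program
  /-- cell := 0 -/
  | fzero : Cell → Program
  /-- cell := 1 -/
  | fone : Cell → Program
  /-- first cell := second + third -/
  | fadd : Cell → Cell → Cell → Program
  /-- first cell := second - third -/
  | fsub : Cell → Cell → Cell → Program
  /-- first cell := second * third -/
  | fmul : Cell → Cell → Cell → Program
  /-- first cell := second / third (0 if the third is 0) -/
  | fdiv : Cell → Cell → Cell → Program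
  /-- if the cell is 0 then run the first program, else the second -/
  | ifZero : Cell → Program → Program → Program
  /-- if first register < second register then run the first program, else the second -/
  | ifLt : ℕ → ℕ → Program → Program → Program
  /-- repeat the program as often as the register says on entry -/
  | loop : ℕ → Program → Program

/-- Machine states: the index registers and the field memory. -/
structure MState (F : Type*) where
  reg : ℕ → ℕ
  mem : ℕ → ℕ → ℕ → F

namespace MState

variable {F : Type*}

/-- The content of a cell. -/
def get (s : MState F) (x : Cell) : F := s.mem x.arr (s.reg x.row) (s.reg x.col)

/-- Write `y` into the cell `x`. -/
def put (s : MState F) (x : Cell) (y : F) : MState F where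
  reg := s.reg
  mem := fun a i j =>
    if a = x.arr ∧ i = s.reg x.row ∧ j = s.reg x.col then y else s.mem a i j

/-- Write `t` into the index register `r`. -/
def setReg (s : MState F) (r t : ℕ) : MState F where
  reg := Function.update s.reg r t
  mem := s.mem

end MState

namespace Program

variable {F : Type*} [Field F]

open Classical in
/-- The state after running a program. -/
noncomputable def exec : Program → MState F → MState F
  | seq p p', s => exec p' (exec p s)
  | reset r, s => s.setReg r 0
  | incr r, s => s.setReg r (s.reg r + 1)
  | copy r r', s => s.setReg r (s.reg r')
  | fzero x, s => s.put x 0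
  | fone x, s => s.put x 1
  | fadd x y z, s => s.put x (s.get y + s.get z)
  | fsub x y z, s => s.put x (s.get y - s.get z)
  | fmul x y z, s => s.put x (s.get y * s.get z)
  | fdiv x y z, s => s.put x (s.get y / s.get z)
  | ifZero x p p', s => if s.get x = 0 then exec p s else exec p' s
  | ifLt r r' p p', s => if s.reg r < s.reg r' then exec p s else exec p' s
  | loop r p, s => (exec p)^[s.reg r] s

open Classical in
/-- The number of steps that a program takes. -/
noncomputable def steps : Program → MState F → ℕ
  | seq p p', s => steps p s + steps p' (exec p s)
  | ifZero x p p', s => 1 + if s.get x = 0 then steps p s else steps p' s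
  | ifLt r r' p p', s => 1 + if s.reg r < s.reg r' then steps p s else steps p' s
  | loop r p, s => 1 + ∑ i ∈ Finset.range (s.reg r), (1 + steps p ((exec p)^[i] s))
  | _, _ => 1

end Program

section Distinguisher

variable {F : Type*} [Field F]

/-- The initial state: registers `0`, `1`, `2` hold the length `n`, the dimension `k` and the number
`l` of blocks, array `0` holds the `k × n` matrix, and everything else is zero. -/
def inputState {k n : ℕ} (l : ℕ) (G : Matrix (Fin k) (Fin n) F) : MState F where
  reg := fun r => if r = 0 then n else if r = 1 then k else if r = 2 then l else 0
  mem := fun a i j => if h : a = 0 ∧ i < k ∧ j < n then G ⟨i, h.2.1⟩ ⟨j, h.2.2⟩ else 0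

/-- The number of steps of the program `P` on the matrix `G`. -/
noncomputable def runningTime (P : Program) {k n : ℕ} (l : ℕ) (G : Matrix (Fin k) (Fin n) F) : ℕ :=
  P.steps (inputState l G)

/-- The program `P` declares the code generated by `G` to be a GLRS code: it leaves `1` in
register `0`. -/
def DeclaresGLRS (P : Program) {k n : ℕ} (l : ℕ) (G : Matrix (Fin k) (Fin n) F) : Prop :=
  (P.exec (inputState l G)).reg 0 = 1

/-- The number that `P` leaves in register `1`. -/
noncomputable def outputDim (P : Program) {k n : ℕ} (l : ℕ) (G : Matrix (Fin k) (Fin n) F) : ℕ :=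
  (P.exec (inputState l G)).reg 1

end Distinguisher

/-!
A program computes the dimension of the square code by inserting the products `g_i * g_j` of two
rows of the generator matrix, one after another, into a row echelon form. There are `k ^ 2` products
and each insertion takes `O (n ^ 2)` steps, so that `O (n ^ 4)` steps suffice. The invariant is
`IsElimination`, the loops are treated by `Program.exec_forReg_induction`, and the number of steps is
read off from the nesting of loops in the program text (`Program.InputLoops.steps_le`).

For the identity automorphism, `skewEval` at `b` with parameter `a` is `b * f a` for the ordinary
polynomial `f`. Up to column multipliers and repetition of columns, the square of a GLRS code thus
consists of the evaluations, at `l` distinct points, of the polynomials of degree less than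
`2 * k - 1`, and has dimension `min l (2 * k - 1)` (`IsGLRS.finrank_squareCode`).

It remains to see that the square of a random code has dimension at least `2 * k`. A random code is
the row space of a random matrix (`randomCodeProb_le`), and its square has dimension at least `2 * k`
if the Veronese images (the vectors of products of two coordinates) of the first `2 * k` columns are
linearly independent. By adding one column after another
(`card_not_linearIndependent_le`), it is enough to bound the probability that the Veronese image of
a random point `p` of `F ^ k` lies in a given subspace `V` of dimension less than `2 * k`. As
`2 * k ≤ k * (k + 1) / 2`, such points lie on a quadric, which gives the bound `2 / q` of
`card_veronese_mem_le`; this suffices when `k` is bounded. When `k` is large, split `p` into vectors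
`g` and `h` with about `k / 6` and `5 * k / 6` coordinates, so that `g ⊗ h` has to lie in the image
of `V`. For linearly independent `g` the spaces of such `h` have total dimension at most `dim V`;
hence outside a plane of exceptional `g` each of them has dimension at most about `2 * k / 3`, and the
probability is exponentially small in `k` (`card_veronese_mem_le_pow`).
-/

/-! ### Linear independence of random tuples, and quadrics over finite fields -/

open Classical in
/-- If every subspace of dimension less than `m` contains the image of at most a proportion `b` of
the points of `X`, then a random `j`-tuple of points, `j ≤ m`, has linearly dependent images with
probability at most `j * b`: each point is added to the span of the images of the previous ones. -/
theorem card_not_linearIndependent_le {F E X : Type*} [Field F] [AddCommGroup E] [Module F E]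
    [FiniteDimensional F E] [Fintype X] (φ : X → E) (m : ℕ) (b : ℝ)
    (h : ∀ V : Submodule F E, Module.finrank F V < m →
      ((Finset.univ.filter fun x => φ x ∈ V).card : ℝ) ≤ b * Fintype.card X) :
    ∀ j ≤ m, ((Finset.univ.filter fun x : Fin j → X =>
      ¬ LinearIndependent F (fun i => φ (x i))).card : ℝ) ≤ j * b * (Fintype.card X : ℝ) ^ j := by
  intro j
  induction j with
  | zero =>
    intro _
    simp
  | succ j ih =>
    intro hj
    have ih := ih (by omega)
    set A : Finset (Fin j → X) := Finset.univ.filter fun x : Fin j → X =>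
      ¬ LinearIndependent F (fun i => φ (x i)) with hA
    set V : (Fin j → X) → Submodule F E := fun x => Submodule.span F (Set.range fun i => φ (x i))
    have hsub : (Finset.univ.filter fun x : Fin (j + 1) → X =>
        ¬ LinearIndependent F (fun i => φ (x i))).card ≤
        (A.sigma (fun _ => (Finset.univ : Finset X)) ∪
          (Finset.univ : Finset (Fin j → X)).sigma
            (fun y => Finset.univ.filter fun x => φ x ∈ V y)).card := by
      refine Finset.card_le_card_of_injOn (fun x => ⟨Fin.tail x, x 0⟩) ?_ ?_
      · intro x hx
        simp only [Finset.coe_filter, Finset.mem_univ, true_and, Set.mem_ofPred_eq,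
          linearIndependent_finSucc, not_and_or, not_not] at hx
        rcases hx with hx | hx
        · simp only [Finset.coe_union, Set.mem_union]
          left
          simp only [Finset.mem_coe, Finset.mem_sigma, hA, Finset.mem_filter, Finset.mem_univ,
            true_and, and_true]
          exact hx
        · simp only [Finset.coe_union, Set.mem_union]
          right
          simp only [Finset.mem_coe, Finset.mem_sigma, Finset.mem_filter, Finset.mem_univ,
            true_and]
          exact hx
      · intro x _ y _ hxy
        simp only [Sigma.mk.injEq, heq_eq_eq] at hxy
        rw [← Fin.cons_self_tail x, ← Fin.cons_self_tail y, hxy.1, hxy.2]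
    have h1 : ((Finset.univ.filter fun x : Fin (j + 1) → X =>
        ¬ LinearIndependent F (fun i => φ (x i))).card : ℝ) ≤
        (A.card : ℝ) * Fintype.card X +
          ∑ y : Fin j → X, ((Finset.univ.filter fun x => φ x ∈ V y).card : ℝ) := by
      have := hsub.trans (Finset.card_union_le _ _)
      rw [Finset.card_sigma, Finset.card_sigma, Finset.sum_const, smul_eq_mul,
        Finset.card_univ] at this
      exact_mod_cast this
    have h2 : ∑ y : Fin j → X, ((Finset.univ.filter fun x => φ x ∈ V y).card : ℝ) ≤
        (Fintype.card X : ℝ) ^ j * (b * Fintype.card X) := by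
      calc _ ≤ ∑ _y : Fin j → X, b * (Fintype.card X : ℝ) := by
            refine Finset.sum_le_sum fun y _ => h _ ?_
            have := finrank_range_le_card (R := F) (fun i => φ (y i))
            simp only [Set.finrank, Fintype.card_fin] at this
            exact lt_of_le_of_lt this (by omega)
        _ = _ := by simp
    have h3 := mul_le_mul_of_nonneg_right ih (Nat.cast_nonneg (α := ℝ) (Fintype.card X))
    push_cast
    calc _ ≤ _ := h1
      _ ≤ _ := add_le_add h3 h2
      _ = _ := by ring

/-- The vector of all products of two coordinates of `p`, indexed by unordered pairs. -/
def veronese {ι F : Type*} [Field F] (p : ι → F) : Sym2 ι → F := fun s => (s.map p).mul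

@[simp] theorem veronese_mk {ι F : Type*} [Field F] (p : ι → F) (i j : ι) :
    veronese p s(i, j) = p i * p j := rfl

/-- A proper subspace lies in the kernel of a nonzero functional, given by its coefficients. -/
theorem exists_coeff_ne_zero_of_finrank_lt {F κ : Type*} [Field F] [Fintype κ]
    (V : Submodule F (κ → F)) (hV : Module.finrank F V < Fintype.card κ) :
    ∃ c : κ → F, c ≠ 0 ∧ ∀ x ∈ V, ∑ s, c s * x s = 0 := by
  classical
  have hlt : V < ⊤ := by
    refine lt_top_iff_ne_top.2 fun h => ?_
    rw [h, finrank_top, Module.finrank_fintype_fun_eq_card] at hV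
    exact lt_irrefl _ hV
  obtain ⟨f, hf, hle⟩ := Submodule.exists_le_ker_of_lt_top V hlt
  refine ⟨fun s => f (Pi.single s 1), fun h0 => hf ?_, fun x hx => ?_⟩
  · refine LinearMap.pi_ext' fun s => LinearMap.ext_ring ?_
    simpa using congrFun h0 s
  · have : f x = 0 := hle hx
    rw [← this]
    conv_rhs => rw [pi_eq_sum_univ' x]
    simp [mul_comm]

/-- A quadric, given by coefficients indexed by unordered pairs, contains at most a proportion
`2 / q` of all points. -/
theorem card_veronese_mem_le_two_div {F : Type*} [Field F] [Fintype F] [DecidableEq F] (k : ℕ)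
    (c : Sym2 (Fin k) → F) (hc : c ≠ 0) :
    ((Finset.univ.filter fun p : Fin k → F => ∑ s, c s * veronese p s = 0).card : ℝ) ≤
      2 / Fintype.card F * Fintype.card (Fin k → F) := by
  set P : MvPolynomial (Fin k) F :=
    ∑ s, MvPolynomial.monomial (Sym2.lift ⟨fun i j => Finsupp.single i 1 + Finsupp.single j 1,
      fun i j => add_comm _ _⟩ s) (c s) with hP
  -- different unordered pairs give different monomials, so `P ≠ 0`
  have hinj : Function.Injective (Sym2.lift ⟨fun i j : Fin k =>
      (Finsupp.single i 1 + Finsupp.single j 1 : Fin k →₀ ℕ), fun i j => add_comm _ _⟩) := by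
    intro s t
    induction s with | _ i j
    induction t with | _ a b
    intro h
    simp only [Sym2.lift_mk] at h
    have hi := DFunLike.congr_fun h i
    have hj := DFunLike.congr_fun h j
    have ha := DFunLike.congr_fun h a
    have hb := DFunLike.congr_fun h b
    simp only [Finsupp.add_apply, Finsupp.single_apply] at hi hj ha hb
    rw [Sym2.eq_iff]
    grind
  have hP0 : P ≠ 0 := by
    intro h0
    refine hc (funext fun s => ?_)
    have := congrArg (MvPolynomial.coeff (Sym2.lift ⟨fun i j : Fin k =>
      (Finsupp.single i 1 + Finsupp.single j 1 : Fin k →₀ ℕ), fun i j => add_comm _ _⟩ s)) h0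
    rw [hP, MvPolynomial.coeff_sum, Finset.sum_eq_single s] at this
    · simpa using this
    · intro t _ hts
      rw [MvPolynomial.coeff_monomial, if_neg fun h => hts (hinj h)]
    · simp
  have hdeg : P.totalDegree ≤ 2 := by
    refine MvPolynomial.totalDegree_finsetSum_le fun s _ => ?_
    refine (MvPolynomial.totalDegree_monomial_le _ _).trans ?_
    induction s with | _ i j
    simp [Finsupp.sum_add_index']
  have heval : ∀ p, MvPolynomial.eval p P = ∑ s, c s * veronese p s := by
    intro p
    rw [hP, map_sum]
    refine Finset.sum_congr rfl fun s _ => ?_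
    induction s with | _ i j
    simp [MvPolynomial.eval_monomial, Finsupp.prod_add_index', pow_add]
  have hq : (0 : ℝ) < Fintype.card F := by exact_mod_cast Fintype.card_pos
  have := MvPolynomial.schwartz_zippel_totalDegree hP0 (Finset.univ : Finset F)
  simp only [heval, Fintype.piFinset_univ, Finset.card_univ] at this
  have h2 : ((Finset.univ.filter fun p : Fin k → F => ∑ s, c s * veronese p s = 0).card : ℝ) /
      (Fintype.card F : ℝ) ^ k ≤ P.totalDegree / Fintype.card F := by
    have h3 := (NNRat.cast_le (K := ℝ)).2 this
    push_cast at h3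
    exact h3
  rw [div_le_iff₀ (by positivity)] at h2
  refine h2.trans ?_
  rw [Fintype.card_fun, Fintype.card_fin]
  push_cast
  gcongr
  exact_mod_cast hdeg

open Classical in
/-- Over a field with `q` elements, the products of pairs of coordinates of a random point of
`F ^ k` lie in a subspace of dimension less than `2 * k` with probability at most `2 / q`. -/
theorem card_veronese_mem_le {F : Type*} [Field F] [Fintype F] (k : ℕ) (hk : 2 < k)
    (V : Submodule F (Sym2 (Fin k) → F)) (hV : Module.finrank F V < 2 * k) :
    ((Finset.univ.filter fun p : Fin k → F => veronese p ∈ V).card : ℝ) ≤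
      2 / Fintype.card F * Fintype.card (Fin k → F) := by
  have hcard : 2 * k ≤ Fintype.card (Sym2 (Fin k)) := by
    rw [Sym2.card, Fintype.card_fin, Nat.choose_two_right, Nat.le_div_iff_mul_le (by norm_num)]
    simp only [Nat.add_sub_cancel]
    nlinarith
  obtain ⟨c, hc, h⟩ := exists_coeff_ne_zero_of_finrank_lt V (hV.trans_le hcard)
  refine le_trans ?_ (card_veronese_mem_le_two_div k c hc)
  exact_mod_cast Finset.card_le_card fun p hp => by
    simp only [Finset.mem_filter, Finset.mem_univ, true_and] at hp ⊢
    exact h _ hp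

/-! ### Pure tensors in a subspace -/

/-- The linear map `h ↦ g ⊗ h`. -/
def outerMap {F α β : Type*} [Field F] (g : α → F) : (β → F) →ₗ[F] (α → β → F) where
  toFun h := fun a b => g a * h b
  map_add' x y := by funext a b; simp [mul_add]
  map_smul' r x := by funext a b; simp; ring

/-- For linearly independent `g i`, the subspaces `{h | g i ⊗ h ∈ V}` have total dimension at most
that of `V`. -/
theorem sum_finrank_comap_outerMap_le {F α β ι : Type*} [Field F] [Finite α] [Finite β]
    [Fintype ι] (V : Submodule F (α → β → F)) (g : ι → α → F) (hg : LinearIndependent F g) :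
    ∑ i, Module.finrank F (V.comap (outerMap (g i))) ≤ Module.finrank F V := by
  cases nonempty_fintype α
  cases nonempty_fintype β
  let T : (∀ i, V.comap (outerMap (β := β) (g i))) →ₗ[F] V :=
    { toFun := fun h => ∑ i, ⟨outerMap (g i) (h i : β → F), (h i).2⟩
      map_add' := fun x y => by
        rw [← Finset.sum_add_distrib]
        refine Finset.sum_congr rfl fun i _ => ?_
        ext1
        simp
      map_smul' := fun r x => by
        rw [Finset.smul_sum]
        refine Finset.sum_congr rfl fun i _ => ?_
        ext1
        simp }
  have hT : Function.Injective T := by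
    rw [← LinearMap.ker_eq_bot, LinearMap.ker_eq_bot']
    intro h h0
    have h1 : ∑ i, outerMap (g i) (h i : β → F) = 0 := by
      have := congrArg (Submodule.subtype V) h0
      simpa [T] using this
    funext i
    ext b
    have h2 : ∑ i, (h i : β → F) b • g i = 0 := by
      funext a
      have := congrFun (congrFun h1 a) b
      simpa [outerMap, Finset.sum_apply, mul_comm] using this
    simpa using Fintype.linearIndependent_iff.1 hg _ h2 i
  rw [← Module.finrank_pi_fintype]
  exact LinearMap.finrank_le_finrank_of_injective hT

open Classical in
/-- If `dim V < 3 * D`, the vectors `g` with `dim {h | g ⊗ h ∈ V} ≥ D` span at most a plane. -/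
theorem card_le_finrank_comap_outerMap_le {F α β : Type*} [Field F] [Fintype F] [Fintype α]
    [Fintype β] [DecidableEq α] [DecidableEq β] (V : Submodule F (α → β → F)) (D : ℕ) (hD : Module.finrank F V < 3 * D) :
    (Finset.univ.filter fun g : α → F =>
      D ≤ Module.finrank F (V.comap (outerMap g))).card ≤ Fintype.card F ^ 2 := by
  set S : Set (α → F) := {g | D ≤ Module.finrank F (V.comap (outerMap g))} with hS
  obtain ⟨b, hbS, hspan, hb⟩ := exists_linearIndependent F S
  have hfin : Module.finrank F (Submodule.span F S) ≤ 2 := by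
    by_contra! hlt
    have hbf : Fintype b := Fintype.ofFinite b
    rw [← hspan, ← Subtype.range_coe (s := b), finrank_span_eq_card hb] at hlt
    have hle : Fintype.card (Fin 3) ≤ Fintype.card b := by
      rw [Fintype.card_fin]
      exact hlt
    obtain ⟨e⟩ := Function.Embedding.nonempty_of_card_le hle
    have := sum_finrank_comap_outerMap_le V _ (hb.comp e e.injective)
    have h3 : ∀ i : Fin 3, D ≤ Module.finrank F
        (V.comap (outerMap (β := β) (((Subtype.val : b → α → F) ∘ e) i))) :=
      fun i => hbS (e i).2
    have h4 := Finset.sum_le_sum fun i (_ : i ∈ Finset.univ) => h3 i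
    simp only [Finset.sum_const, Finset.card_univ, Fintype.card_fin, smul_eq_mul] at h4
    omega
  calc _ ≤ (Finset.univ.filter fun g : α → F => g ∈ Submodule.span F S).card :=
        Finset.card_le_card fun g hg => by
          simp only [Finset.mem_filter, Finset.mem_univ, true_and] at hg ⊢
          exact Submodule.subset_span hg
    _ = Fintype.card (Submodule.span F S) := (Fintype.card_subtype _).symm
    _ = Fintype.card F ^ Module.finrank F (Submodule.span F S) := Module.card_eq_pow_finrank
    _ ≤ _ := Nat.pow_le_pow_right Fintype.card_pos hfin

open Classical in
/-- A bound for the number of pure tensors, with multiplicity, in a subspace `V` of dimension less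
than `3 * (D + 1)`: either `g` lies in a plane, or at most `q ^ D` vectors `h` satisfy
`g ⊗ h ∈ V`. -/
theorem card_outerMap_mem_le {F α β : Type*} [Field F] [Fintype F] [Fintype α]
    [Fintype β] [DecidableEq α] [DecidableEq β] (V : Submodule F (α → β → F)) (D : ℕ)
    (hD : Module.finrank F V < 3 * (D + 1)) :
    (Finset.univ.filter fun x : (α → F) × (β → F) => outerMap x.1 x.2 ∈ V).card ≤
      Fintype.card F ^ (2 + Fintype.card β) + Fintype.card F ^ (Fintype.card α + D) := by
  set S : Finset (α → F) := Finset.univ.filter fun g : α → F =>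
      D + 1 ≤ Module.finrank F (V.comap (outerMap (β := β) g)) with hS
  have hsub : (Finset.univ.filter fun x : (α → F) × (β → F) => outerMap x.1 x.2 ∈ V).card ≤
      (S.sigma (fun _ => (Finset.univ : Finset (β → F))) ∪
        (Finset.univ \ S).sigma (fun g => Finset.univ.filter fun h => outerMap g h ∈ V)).card := by
    refine Finset.card_le_card_of_injOn (fun x => ⟨x.1, x.2⟩) ?_ ?_
    · intro x hx
      by_cases hxS : x.1 ∈ S
      · simp [hxS]
      · simpa [hxS] using hx
    · intro x _ y _ hxy
      simp only [Sigma.mk.injEq, heq_eq_eq] at hxy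
      exact Prod.ext hxy.1 hxy.2
  refine hsub.trans ((Finset.card_union_le _ _).trans (add_le_add ?_ ?_))
  · rw [Finset.card_sigma, Finset.sum_const, smul_eq_mul, Finset.card_univ, Fintype.card_fun,
      pow_add]
    exact Nat.mul_le_mul_right _ (card_le_finrank_comap_outerMap_le V (D + 1) hD)
  · rw [Finset.card_sigma]
    calc _ ≤ ∑ g ∈ Finset.univ \ S, Fintype.card F ^ D := by
          refine Finset.sum_le_sum fun g hg => ?_
          have hg' : Module.finrank F (V.comap (outerMap (β := β) g)) ≤ D := by
            simpa [hS, Nat.lt_succ_iff] using hg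
          calc _ = Fintype.card (V.comap (outerMap (β := β) g)) :=
                (Fintype.card_subtype _).symm
            _ = Fintype.card F ^ Module.finrank F (V.comap (outerMap (β := β) g)) :=
                Module.card_eq_pow_finrank
            _ ≤ _ := Nat.pow_le_pow_right Fintype.card_pos hg'
      _ ≤ Fintype.card (α → F) * Fintype.card F ^ D := by
          rw [Finset.sum_const, smul_eq_mul]
          exact Nat.mul_le_mul_right _ (Finset.card_le_univ _)
      _ = _ := by rw [Fintype.card_fun, pow_add]

open Classical in
/-- The bound on `card_veronese_mem_le` that decays with `k`, uniformly in the field. The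
coordinates are split into `s` and `k - s` of them, and only products of a coordinate of the first
group and one of the second are used. -/
theorem card_veronese_mem_le_pow {F : Type*} [Field F] [Fintype F] (k s : ℕ) (hs : 2 ≤ s)
    (hk : 6 * s ≤ k)
    (V : Submodule F (Sym2 (Fin k) → F)) (hV : Module.finrank F V < 2 * k) :
    ((Finset.univ.filter fun p : Fin k → F => veronese p ∈ V).card : ℝ) ≤
      2 / 2 ^ (s - 2) * Fintype.card (Fin k → F) := by
  obtain ⟨r, rfl⟩ : ∃ r, k = s + r := ⟨k - s, by omega⟩
  obtain ⟨T, hT⟩ : ∃ T : (Sym2 (Fin (s + r)) → F) →ₗ[F] (Fin s → Fin r → F),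
      ∀ f a b, T f a b = f s(Fin.castAdd r a, Fin.natAdd s b) :=
    ⟨{ toFun := fun f a b => f s(Fin.castAdd r a, Fin.natAdd s b)
       map_add' := fun _ _ => rfl
       map_smul' := fun _ _ => rfl }, fun _ _ _ => rfl⟩
  -- `D = k - 2 * s` is at least `2 * k / 3`, and the factor `q ^ s` for the choice of `g` still
  -- leaves `q ^ (s + D) = q ^ (k - s)`
  set D := s + r - 2 * s with hDdef
  have hfin : Module.finrank F (V.map T) < 3 * (D + 1) := by
    have := Submodule.finrank_map_le T V
    omega
  have h1 := card_outerMap_mem_le (V.map T) D hfin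
  simp only [Fintype.card_fin] at h1
  have h2 : (Finset.univ.filter fun p : Fin (s + r) → F => veronese p ∈ V).card ≤
      Fintype.card F ^ (2 + r) + Fintype.card F ^ (s + D) := by
    refine le_trans ?_ h1
    refine Finset.card_le_card_of_injOn
      (fun p => (fun a => p (Fin.castAdd r a), fun b => p (Fin.natAdd s b))) ?_ ?_
    · intro p hp
      have hp : veronese p ∈ V := (Finset.mem_filter.1 hp).2
      exact Finset.mem_filter.2 ⟨Finset.mem_univ _, Submodule.mem_map.2 ⟨_, hp, by
        funext a b
        simp [hT, outerMap]⟩⟩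
    · intro p _ p' _ h
      rw [Prod.mk.injEq] at h
      funext i
      exact Fin.addCases (fun a => congrFun h.1 a) (fun b => congrFun h.2 b) i
  have hq : 2 ≤ Fintype.card F := Fintype.one_lt_card
  have h3 : 2 ^ (s - 2) * (Finset.univ.filter fun p : Fin (s + r) → F => veronese p ∈ V).card ≤
      2 * Fintype.card (Fin (s + r) → F) := by
    rw [Fintype.card_fun, Fintype.card_fin]
    calc _ ≤ Fintype.card F ^ (s - 2) *
          (Fintype.card F ^ (2 + r) + Fintype.card F ^ (s + D)) :=
          Nat.mul_le_mul (Nat.pow_le_pow_left hq _) h2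
      _ = Fintype.card F ^ (s + r) + Fintype.card F ^ (s - 2 + (s + D)) := by
          rw [mul_add, ← pow_add, ← pow_add]
          congr 2
          omega
      _ ≤ Fintype.card F ^ (s + r) + Fintype.card F ^ (s + r) := by
          refine Nat.add_le_add_left (Nat.pow_le_pow_right (by omega) ?_) _
          omega
      _ = _ := by ring
  rw [div_mul_eq_mul_div, le_div_iff₀ (by positivity), mul_comm]
  exact_mod_cast h3

/-! ### Squares of random codes -/

/-- If the Veronese images of `2 * k` columns are linearly independent, then the products of two
rows span a space of dimension at least `2 * k`. -/
theorem two_mul_le_finrank_squareCode {F : Type*} [Field F] {k n m : ℕ}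
    (M : Fin k → Fin n → F) (e : Fin m → Fin n)
    (h : LinearIndependent F (fun t => veronese (fun i => M i (e t)))) :
    m ≤ Module.finrank F (squareCode (Submodule.span F (Set.range M))) := by
  let A : Matrix (Sym2 (Fin k)) (Fin m) F :=
    Matrix.of fun s t => veronese (fun i => M i (e t)) s
  have hrank : A.rank = m := by
    rw [Matrix.rank_eq_finrank_span_cols]
    have : LinearIndependent F A.col := h
    rw [finrank_span_eq_card this, Fintype.card_fin]
  let R : (Fin n → F) →ₗ[F] (Fin m → F) := LinearMap.funLeft F F e
  rw [← hrank, Matrix.rank_eq_finrank_span_row]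
  refine (Submodule.finrank_mono ?_).trans (Submodule.finrank_map_le R _)
  rw [Submodule.span_le]
  rintro _ ⟨s, rfl⟩
  induction s with | _ i j
  exact Submodule.mem_map.2 ⟨fun c => M i c * M j c,
    Submodule.subset_span ⟨_, Submodule.subset_span ⟨i, rfl⟩, _, Submodule.subset_span ⟨j, rfl⟩,
      rfl⟩, rfl⟩

open Classical in
/-- Most `k`-tuples of vectors of `F ^ n` are linearly independent when `2 * k ≤ n`. -/
theorem half_card_le_card_linearIndependent {F : Type*} [Field F] [Fintype F] (n k : ℕ)
    (hk : 2 < k) (hn : 2 * k ≤ n) :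
    (Fintype.card (Fin n → F) : ℝ) ^ k / 2 ≤
      (Finset.univ.filter fun M : Fin k → Fin n → F => LinearIndependent F M).card := by
  have hq : 2 ≤ Fintype.card F := Fintype.one_lt_card
  have hq' : (2 : ℝ) ≤ Fintype.card F := by exact_mod_cast hq
  -- a subspace of dimension less than `k` has at most `q ^ (k - 1)` of the `q ^ n` vectors
  have h := card_not_linearIndependent_le (F := F) (fun x : Fin n → F => x) k
    ((Fintype.card F : ℝ) ^ (k - 1) / (Fintype.card F : ℝ) ^ n) (fun V hV => by
      rw [Fintype.card_fun, Fintype.card_fin]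
      push_cast
      rw [div_mul_cancel₀ _ (by positivity), ← Fintype.card_subtype]
      have h1 : Fintype.card V = Fintype.card F ^ Module.finrank F V :=
        Module.card_eq_pow_finrank
      have h2 : Fintype.card {x // x ∈ V} ≤ Fintype.card F ^ (k - 1) := by
        refine (le_of_eq ?_).trans (h1.le.trans (Nat.pow_le_pow_right (by omega) (by omega)))
        exact Fintype.card_congr (Equiv.refl _)
      exact_mod_cast h2) k le_rfl
  have h3 : (k : ℝ) * ((Fintype.card F : ℝ) ^ (k - 1) / (Fintype.card F : ℝ) ^ n) ≤ 1 / 2 := by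
    rw [← mul_div_assoc, div_le_div_iff₀ (by positivity) (by norm_num), one_mul]
    have h4 : k * Fintype.card F ^ (k - 1) * 2 ≤ Fintype.card F ^ n := by
      calc _ ≤ Fintype.card F ^ k * Fintype.card F ^ (k - 1) * Fintype.card F := by
            gcongr
            exact (Nat.lt_pow_self hq).le
        _ = Fintype.card F ^ (2 * k) := by
            rw [← pow_add, ← pow_succ]
            congr 1
            omega
        _ ≤ _ := Nat.pow_le_pow_right (by omega) hn
    exact_mod_cast h4
  have hsum := Finset.card_filter_add_card_filter_not
    (s := (Finset.univ : Finset (Fin k → Fin n → F)))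
    (fun M : Fin k → Fin n → F => LinearIndependent F M)
  rw [Finset.card_univ, Fintype.card_fun (α := Fin k), Fintype.card_fin] at hsum
  have hsum' : ((Finset.univ.filter fun M : Fin k → Fin n → F =>
      LinearIndependent F M).card : ℝ) + ((Finset.univ.filter fun M : Fin k → Fin n → F =>
      ¬ LinearIndependent F M).card : ℝ) = (Fintype.card (Fin n → F) : ℝ) ^ k := by
    exact_mod_cast hsum
  have h5 := h.trans (mul_le_mul_of_nonneg_right h3 (by positivity))
  linarith

open Classical in
/-- All `k`-dimensional codes have the same number of ordered bases. -/
theorem card_bases_eq {F : Type*} [Field F] [Fintype F] {n k : ℕ}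
    (C : Submodule F (Fin n → F)) (hC : Module.finrank F C = k) :
    (Finset.univ.filter fun M : Fin k → Fin n → F =>
      LinearIndependent F M ∧ Submodule.span F (Set.range M) = C).card =
      ∏ i : Fin k, (Fintype.card F ^ k - Fintype.card F ^ (i : ℕ)) := by
  have h := card_linearIndependent (K := F) (V := C) hC.ge
  rw [hC] at h
  rw [← h, ← Fintype.card_subtype, ← Nat.card_eq_fintype_card]
  refine Nat.card_congr
    { toFun := fun M => ⟨fun i => ⟨M.1 i, M.2.2.le (Submodule.subset_span ⟨i, rfl⟩)⟩, ?_⟩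
      invFun := fun M => ⟨fun i => (M.1 i : Fin n → F), ?_, ?_⟩
      left_inv := fun M => rfl
      right_inv := fun M => rfl }
  · exact LinearIndependent.of_comp C.subtype M.2.1
  · exact M.2.map' C.subtype (Submodule.ker_subtype C)
  · refine Submodule.eq_of_le_of_finrank_eq ?_ ?_
    · rw [Submodule.span_le]
      rintro _ ⟨i, rfl⟩
      exact (M.1 i).2
    · have := M.2.map' C.subtype (Submodule.ker_subtype C)
      have h2 := finrank_span_eq_card this
      rw [Fintype.card_fin] at h2
      rw [hC]
      exact h2

open Classical in
/-- Double counting of ordered bases of codes. -/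
theorem ncard_mul_card_bases {F : Type*} [Field F] [Fintype F] {n k : ℕ}
    (E : Set (Submodule F (Fin n → F))) :
    Set.ncard {C : Submodule F (Fin n → F) | Module.finrank F C = k ∧ C ∈ E} *
      (∏ i : Fin k, (Fintype.card F ^ k - Fintype.card F ^ (i : ℕ))) =
    (Finset.univ.filter fun M : Fin k → Fin n → F =>
      LinearIndependent F M ∧ Submodule.span F (Set.range M) ∈ E).card := by
  have hfin : Fintype (Submodule F (Fin n → F)) := Fintype.ofFinite _
  rw [Set.ncard_eq_toFinset_card']
  rw [Finset.card_eq_sum_card_fiberwise (f := fun M => Submodule.span F (Set.range M))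
    (t := {C : Submodule F (Fin n → F) | Module.finrank F C = k ∧ C ∈ E}.toFinset)]
  · rw [Finset.sum_congr rfl, Finset.sum_const, smul_eq_mul]
    intro C hC
    simp only [Set.mem_toFinset, Set.mem_ofPred_eq] at hC
    rw [Finset.filter_filter, ← card_bases_eq C hC.1]
    congr 1
    ext M
    simp only [Finset.mem_filter, Finset.mem_univ, true_and]
    constructor
    · rintro ⟨⟨h1, h2⟩, h3⟩
      exact ⟨h1, h3⟩
    · rintro ⟨h1, h3⟩
      exact ⟨⟨h1, h3 ▸ hC.2⟩, h3⟩
  · intro M hM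
    simp only [Finset.coe_filter, Finset.mem_univ, true_and, Set.mem_ofPred_eq] at hM
    simp only [Set.coe_toFinset, Set.mem_ofPred_eq]
    refine ⟨?_, hM.2⟩
    rw [finrank_span_eq_card hM.1, Fintype.card_fin]

open Classical in
/-- An event has, for a random code, at most twice the probability that it has for the row space
of a uniformly random matrix. -/
theorem randomCodeProb_le {F : Type*} [Field F] [Fintype F] (n k : ℕ)
    (hk : 2 < k) (hn : 2 * k ≤ n) (E : Set (Submodule F (Fin n → F))) (b : ℝ)
    (h : ((Finset.univ.filter fun M : Fin k → Fin n → F =>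
      Submodule.span F (Set.range M) ∈ E).card : ℝ) ≤ b * (Fintype.card (Fin n → F) : ℝ) ^ k) :
    randomCodeProb k n E ≤ 2 * b := by
  set N := ∏ i : Fin k, (Fintype.card F ^ k - Fintype.card F ^ (i : ℕ)) with hN
  have hNpos : (0 : ℝ) < N := by
    have : 0 < N := Finset.prod_pos fun i _ =>
      Nat.sub_pos_of_lt (Nat.pow_lt_pow_right Fintype.one_lt_card i.2)
    exact_mod_cast this
  have hE : (Set.ncard {C : Submodule F (Fin n → F) | Module.finrank F C = k ∧ C ∈ E} : ℝ) * N
      ≤ b * (Fintype.card (Fin n → F) : ℝ) ^ k := by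
    refine le_trans ?_ h
    have h1 := (ncard_mul_card_bases (k := k) E).le.trans
      (Finset.card_le_card (Finset.monotone_filter_right _ fun M _ hM => hM.2))
    exact_mod_cast h1
  have hA : (Fintype.card (Fin n → F) : ℝ) ^ k / 2 ≤
      (Set.ncard {C : Submodule F (Fin n → F) | Module.finrank F C = k} : ℝ) * N := by
    have h1 := ncard_mul_card_bases (F := F) (n := n) (k := k) Set.univ
    simp only [Set.mem_univ, and_true] at h1
    have h2 := half_card_le_card_linearIndependent (F := F) n k hk hn
    rw [← h1] at h2
    exact_mod_cast h2
  have hpos : (0 : ℝ) < (Fintype.card (Fin n → F) : ℝ) ^ k := by positivity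
  have hApos : (0 : ℝ) < (Set.ncard {C : Submodule F (Fin n → F) | Module.finrank F C = k} : ℝ) :=
    pos_of_mul_pos_left (lt_of_lt_of_le (by positivity) hA) hNpos.le
  have hb : 0 ≤ b := by
    by_contra! hb
    have := mul_neg_of_neg_of_pos hb hpos
    have h0 : (0 : ℝ) ≤ ((Finset.univ.filter fun M : Fin k → Fin n → F =>
      Submodule.span F (Set.range M) ∈ E).card : ℝ) := Nat.cast_nonneg _
    linarith
  rw [randomCodeProb, div_le_iff₀ hApos]
  refine le_of_mul_le_mul_right ?_ hNpos
  have := mul_le_mul_of_nonneg_left hA (by positivity : 0 ≤ 2 * b)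
  linarith

open Classical in
/-- If a subspace of dimension less than `2 * k` contains the Veronese images of at most a
proportion `b` of all points, then the square of a random `k`-dimensional code has dimension less
than `2 * k` with probability at most `4 * k * b`. -/
theorem randomCodeProb_finrank_squareCode_lt_le {F : Type*} [Field F] [Fintype F] (n k : ℕ)
    (hk : 2 < k) (hn : 2 * k ≤ n) (b : ℝ)
    (h : ∀ V : Submodule F (Sym2 (Fin k) → F), Module.finrank F V < 2 * k →
      ((Finset.univ.filter fun p : Fin k → F => veronese p ∈ V).card : ℝ) ≤
        b * Fintype.card (Fin k → F)) :
    randomCodeProb k n {C : Submodule F (Fin n → F) | Module.finrank F (squareCode C) < 2 * k} ≤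
      4 * k * b := by
  obtain ⟨e, rfl⟩ : ∃ e, n = 2 * k + e := ⟨n - 2 * k, by omega⟩
  have h1 := card_not_linearIndependent_le (veronese (ι := Fin k) (F := F)) (2 * k) b h _ le_rfl
  obtain ⟨E, hE⟩ : ∃ E : Set (Submodule F (Fin (2 * k + e) → F)),
      E = {C | Module.finrank F (squareCode C) < 2 * k} := ⟨_, rfl⟩
  rw [← hE]
  refine (randomCodeProb_le _ k hk hn _ ((2 * k : ℕ) * b) ?_).trans (le_of_eq (by push_cast; ring))
  set A := Finset.univ.filter fun x : Fin (2 * k) → Fin k → F =>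
    ¬ LinearIndependent F (fun i => veronese (x i)) with hA
  have h2 : (Finset.univ.filter fun M : Fin k → Fin (2 * k + e) → F =>
      Submodule.span F (Set.range M) ∈ E).card ≤
      (A ×ˢ (Finset.univ : Finset (Fin e → Fin k → F))).card := by
    refine Finset.card_le_card_of_injOn
      (fun M => (fun t i => M i (Fin.castAdd e t), fun t i => M i (Fin.natAdd (2 * k) t))) ?_ ?_
    · intro M hM
      have hM := (Finset.mem_filter.1 hM).2
      rw [hE] at hM
      simp only [Finset.coe_product, Set.mem_prod, Finset.mem_coe, Finset.mem_univ, and_true, hA,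
        Finset.mem_filter, true_and]
      intro hli
      exact absurd (two_mul_le_finrank_squareCode M (Fin.castAdd e) hli) (not_le.2 hM)
    · intro M _ M' _ hMM
      rw [Prod.mk.injEq] at hMM
      funext i t
      exact Fin.addCases (fun a => congrFun (congrFun hMM.1 a) i)
        (fun b => congrFun (congrFun hMM.2 b) i) t
  have h3 : ((Finset.univ.filter fun M : Fin k → Fin (2 * k + e) → F =>
      Submodule.span F (Set.range M) ∈ E).card : ℝ) ≤
      A.card * (Fintype.card (Fin k → F) : ℝ) ^ e := by
    rw [Finset.card_product, Finset.card_univ, Fintype.card_fun (α := Fin e),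
      Fintype.card_fin] at h2
    exact_mod_cast h2
  refine h3.trans ((mul_le_mul_of_nonneg_right h1 (by positivity)).trans (le_of_eq ?_))
  rw [mul_assoc, ← pow_add]
  congr 1
  rw [Fintype.card_fun, Fintype.card_fun, Fintype.card_fin, Fintype.card_fin]
  push_cast
  rw [← pow_mul, ← pow_mul, mul_comm]

/-- The bound `4 * k * b` for the proportion `b = 2 / 2 ^ (s - 2)` with `s = k / 6` tends to `0`. -/
theorem exists_forall_mul_div_two_pow_le (ε : ℝ) (hε : 0 < ε) :
    ∃ K : ℕ, 12 ≤ K ∧ ∀ k, K ≤ k → 4 * (k : ℝ) * (2 / 2 ^ (k / 6 - 2)) ≤ ε := by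
  -- with `m = k / 6` the expression is `32 * k / 2 ^ m`, and `32 * k ≤ 192 * m + 160`
  have h1 := (tendsto_pow_const_div_const_pow_of_one_lt 1 (by norm_num : (1 : ℝ) < 2)).const_mul 192
  have h0 := (tendsto_pow_const_div_const_pow_of_one_lt 0 (by norm_num : (1 : ℝ) < 2)).const_mul 160
  have h := h1.add h0
  simp only [mul_zero, add_zero, pow_one, pow_zero] at h
  obtain ⟨m, hm⟩ := Filter.eventually_atTop.1 (h.eventually (gt_mem_nhds hε))
  refine ⟨6 * m + 12, by omega, fun k hk => ?_⟩
  have h2 := (hm (k / 6) (by omega)).le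
  refine le_trans ?_ h2
  obtain ⟨s, hs⟩ : ∃ s, k / 6 = s + 2 := ⟨k / 6 - 2, by omega⟩
  rw [hs, Nat.add_sub_cancel, ← mul_div_assoc, ← mul_div_assoc, ← mul_div_assoc, ← add_div,
    div_le_div_iff₀ (by positivity) (by positivity), pow_add]
  have hk6 : (k : ℝ) ≤ 6 * ((s + 2 : ℕ) : ℝ) + 5 := by
    have : k ≤ 6 * (s + 2) + 5 := by omega
    exact_mod_cast this
  have hp : (0 : ℝ) < 2 ^ s := by positivity
  nlinarith

/-- The square of a random `k`-dimensional code of length at least `2 * k` has dimension at least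
`2 * k` with probability tending to `1`. -/
theorem exists_randomCodeProb_finrank_squareCode_lt_le (ε : ℝ) (hε : 0 < ε) : ∃ K : ℕ,
    ∀ (F : Type*) [Field F] [Finite F] (n k : ℕ), 2 < k → 2 * k ≤ n → (K ≤ k ∨ K ≤ Nat.card F) →
      randomCodeProb k n
        {C : Submodule F (Fin n → F) | Module.finrank F (squareCode C) < 2 * k} ≤ ε := by
  classical
  obtain ⟨K₀, h12, hK₀⟩ := exists_forall_mul_div_two_pow_le ε hε
  obtain ⟨K₁, hK₁⟩ := exists_nat_ge (8 * (K₀ : ℝ) / ε)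
  refine ⟨max K₀ K₁, fun F _ _ n k hk hn hK => ?_⟩
  cases nonempty_fintype F
  -- for `k < K₀` the quadric bound gives `4 * k * (2 / q) ≤ 8 * K₀ / q`
  by_cases hkK : K₀ ≤ k
  · refine (randomCodeProb_finrank_squareCode_lt_le n k hk hn (2 / 2 ^ (k / 6 - 2))
      fun V hV => ?_).trans (hK₀ k hkK)
    convert card_veronese_mem_le_pow k (k / 6) (by omega) (by omega) V hV
  · have hK' : K₁ ≤ Fintype.card F := by
      rw [Nat.card_eq_fintype_card] at hK
      omega
    have hq : (0 : ℝ) < Fintype.card F := by exact_mod_cast Fintype.card_pos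
    have hkK' : (k : ℝ) ≤ K₀ := by exact_mod_cast (not_le.1 hkK).le
    refine (randomCodeProb_finrank_squareCode_lt_le n k hk hn (2 / Fintype.card F)
      fun V hV => ?_).trans ?_
    · convert card_veronese_mem_le k hk V hV
    · have h1 : 8 * (K₀ : ℝ) / ε ≤ Fintype.card F := hK₁.trans (by exact_mod_cast hK')
      rw [div_le_iff₀ hε] at h1
      rw [← mul_div_assoc, div_le_iff₀ hq]
      linarith

/-! ### Squares of GLRS codes for the identity automorphism -/

/-- The evaluations of the monomials of degree less than `m` at `l` distinct points span a space
of dimension `min l m`. -/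
theorem finrank_span_range_pow {F : Type*} [Field F] {l m : ℕ} (a : Fin l → F)
    (ha : Function.Injective a) :
    Module.finrank F (Submodule.span F
      (Set.range fun (e : Fin m) (i : Fin l) => a i ^ (e : ℕ))) = min l m := by
  let A : Matrix (Fin l) (Fin m) F := Matrix.of fun i e => a i ^ (e : ℕ)
  have hA : Module.finrank F (Submodule.span F
      (Set.range fun (e : Fin m) (i : Fin l) => a i ^ (e : ℕ))) = A.rank :=
    (Matrix.rank_eq_finrank_span_cols A).symm
  rw [hA]
  rcases le_total l m with h | h
  · have hli : LinearIndependent F A.row := by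
      rw [Fintype.linearIndependent_iff]
      intro g hg
      have : g = 0 := by
        refine Matrix.eq_zero_of_forall_pow_sum_mul_pow_eq_zero ha fun e => ?_
        have := congrFun hg (Fin.castLE h e)
        simpa [A, Finset.sum_apply] using this
      exact fun i => congrFun this i
    rw [Matrix.rank_eq_finrank_span_row, finrank_span_eq_card hli, Fintype.card_fin, min_eq_left h]
  · have hli : LinearIndependent F A.col := by
      rw [Fintype.linearIndependent_iff]
      intro g hg
      have : g = 0 := by
        refine Matrix.eq_zero_of_forall_index_sum_mul_pow_eq_zero
          (f := fun i => a (Fin.castLE h i)) (ha.comp (Fin.castLE_injective h)) fun i => ?_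
        have := congrFun hg (Fin.castLE h i)
        simpa [A, Finset.sum_apply] using this
      exact fun i => congrFun this i
    rw [Matrix.rank_eq_finrank_span_cols, finrank_span_eq_card hli, Fintype.card_fin,
      min_eq_right h]

theorem skewOp_refl_iterate {Fq F : Type*} [Field Fq] [Field F] [Algebra Fq F] (γ a b : F)
    (t : ℕ) : (skewOp (AlgEquiv.refl : F ≃ₐ[Fq] F) γ a)^[t] b = b * a ^ t := by
  induction t with
  | zero => simp
  | succ t ih =>
    rw [Function.iterate_succ_apply', ih]
    simp [skewOp, innerDer, pow_succ, mul_assoc]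

/-- For the identity automorphism, the square of a GLRS code is, up to nonzero column multipliers
and repetition of columns, the code of all evaluations of polynomials of degree less than
`2 * k - 1` at the evaluation parameters. -/
theorem IsGLRS.finrank_squareCode {Fq F : Type*} [Field Fq] [Field F] [Algebra Fq F] {γ : F}
    {n k : ℕ} {blk : Composition n} {C : Submodule F (Fin n → F)} (hk : 0 < k)
    (h : IsGLRS (AlgEquiv.refl : F ≃ₐ[Fq] F) γ blk k C) :
    Module.finrank F (squareCode C) = min blk.length (2 * k - 1) := by
  obtain ⟨β, a, v, hconj, -, hβ, hv, rfl⟩ := h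
  have ha : Function.Injective a := fun i j hij => by
    by_contra hne
    exact hconj i j hne ⟨1, one_ne_zero, by simp [innerDer, hij]⟩
  have hβ0 : ∀ j, β j ≠ 0 := fun j => by
    have := (hβ (blk.index j)).ne_zero (blk.invEmbedding j)
    rwa [blk.embedding_comp_inv j] at this
  let u : Fin n → F := fun j => v (blk.index j) * β j
  have hu : ∀ j, u j ≠ 0 := fun j => mul_ne_zero (hv _) (hβ0 j)
  let T : (Fin blk.length → F) →ₗ[F] (Fin n → F) :=
    { toFun := fun x j => u j ^ 2 * x (blk.index j)
      map_add' := fun x y => by funext j; simp [mul_add]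
      map_smul' := fun r x => by funext j; simp; ring }
  have hT : Function.Injective T := by
    intro x y hxy
    funext i
    have hpos : 0 < blk.blocksFun i := blk.one_le_blocksFun i
    have := congrFun hxy (blk.embedding i ⟨0, hpos⟩)
    simp only [T, LinearMap.coe_mk, AddHom.coe_mk, blk.index_embedding] at this
    exact mul_left_cancel₀ (pow_ne_zero 2 (hu _)) this
  have hev : ∀ (f : Fin k → F) (j : Fin n),
      v (blk.index j) * skewEval (AlgEquiv.refl : F ≃ₐ[Fq] F) γ f (a (blk.index j)) (β j) =
        ∑ t, f t * (u j * a (blk.index j) ^ (t : ℕ)) := by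
    intro f j
    rw [skewEval, Finset.mul_sum]
    refine Finset.sum_congr rfl fun t _ => ?_
    rw [skewOp_refl_iterate]
    ring
  have hsq : squareCode (glrsCode (AlgEquiv.refl : F ≃ₐ[Fq] F) γ blk k β a v) =
      (Submodule.span F (Set.range fun (e : Fin (2 * k - 1)) (i : Fin blk.length) =>
        a i ^ (e : ℕ))).map T := by
    refine le_antisymm ?_ ?_
    · refine Submodule.span_le.2 ?_
      rintro _ ⟨_, ⟨f, rfl⟩, _, ⟨g, rfl⟩, rfl⟩
      have : (fun j => (v (blk.index j) * skewEval (AlgEquiv.refl : F ≃ₐ[Fq] F) γ f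
            (a (blk.index j)) (β j)) *
          (v (blk.index j) * skewEval (AlgEquiv.refl : F ≃ₐ[Fq] F) γ g
            (a (blk.index j)) (β j))) =
          T (∑ s : Fin k, ∑ t : Fin k, (f s * g t) • fun i => a i ^ ((s : ℕ) + (t : ℕ))) := by
        funext j
        rw [hev, hev, Finset.sum_mul_sum]
        simp only [T, LinearMap.coe_mk, AddHom.coe_mk, Finset.sum_apply, Pi.smul_apply,
          smul_eq_mul, Finset.mul_sum]
        refine Finset.sum_congr rfl fun s _ => Finset.sum_congr rfl fun t _ => ?_
        ring
      rw [this]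
      refine Submodule.mem_map_of_mem (Submodule.sum_mem _ fun s _ =>
        Submodule.sum_mem _ fun t _ => Submodule.smul_mem _ _ (Submodule.subset_span
          ⟨⟨s + t, by omega⟩, rfl⟩))
    · rw [Submodule.map_span, Submodule.span_le]
      rintro _ ⟨_, ⟨e, rfl⟩, rfl⟩
      have hmem : ∀ s : Fin k, (fun j => u j * a (blk.index j) ^ (s : ℕ)) ∈
          glrsCode (AlgEquiv.refl : F ≃ₐ[Fq] F) γ blk k β a v := fun s =>
        ⟨Pi.single s 1, by
          funext j
          rw [hev]
          simp [Pi.single_apply]⟩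
      refine Submodule.subset_span ⟨_, hmem ⟨min (e : ℕ) (k - 1), by omega⟩, _,
        hmem ⟨e - min (e : ℕ) (k - 1), by omega⟩, ?_⟩
      funext j
      have he : a (blk.index j) ^ (e : ℕ) = a (blk.index j) ^ (min (e : ℕ) (k - 1)) *
          a (blk.index j) ^ ((e : ℕ) - min (e : ℕ) (k - 1)) := by
        rw [← pow_add]
        congr 1
        omega
      simp only [T, LinearMap.coe_mk, AddHom.coe_mk]
      rw [he]
      ring
  rw [hsq, ← finrank_span_range_pow a ha]
  exact (Submodule.equivMapOfInjective T hT _).finrank_eq.symm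

/-! ### Incremental Gaussian elimination -/

/-- The state of an incremental Gaussian elimination. The row `B r` is zero or has its first
nonzero entry in column `r`, and `d` rows are nonzero. The vector `v`, which is being reduced, is
zero in the first `c` columns, and `W` is the span of the rows and of `v`. -/
structure IsElimination {F : Type*} [Field F] {n : ℕ} (B : Fin n → Fin n → F) (v : Fin n → F)
    (d c : ℕ) (W : Submodule F (Fin n → F)) : Prop where
  tri : ∀ r t, t < r → B r t = 0
  zero : ∀ r, B r r = 0 → B r = 0
  card : d = {r | B r r ≠ 0}.ncard
  vanish : ∀ t : Fin n, (t : ℕ) < c → v t = 0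
  span : Submodule.span F (Set.range B) ⊔ Submodule.span F {v} = W

namespace IsElimination

variable {F : Type*} [Field F] {n : ℕ} {B : Fin n → Fin n → F} {v : Fin n → F} {d c : ℕ}
  {W : Submodule F (Fin n → F)}

theorem init : IsElimination (0 : Fin n → Fin n → F) 0 0 n ⊥ where
  tri _ _ _ := rfl
  zero _ _ := rfl
  card := by simp
  vanish _ _ := rfl
  span := by
    rw [eq_bot_iff, sup_le_iff, Submodule.span_le, Submodule.span_le]
    refine ⟨?_, by simp⟩
    rintro _ ⟨r, rfl⟩
    rfl

theorem eq_zero (h : IsElimination B v d n W) : v = 0 := funext fun t => h.vanish t t.2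

theorem load (h : IsElimination B v d n W) (w : Fin n → F) :
    IsElimination B w d 0 (W ⊔ Submodule.span F {w}) where
  tri := h.tri
  zero := h.zero
  card := h.card
  vanish _ ht := absurd ht (Nat.not_lt_zero _)
  span := by
    have := h.span
    rw [h.eq_zero, Submodule.span_zero_singleton, sup_bot_eq] at this
    rw [this]

theorem skip {c : Fin n} (h : IsElimination B v d c W) (hv : v c = 0) :
    IsElimination B v d (c + 1) W where
  tri := h.tri
  zero := h.zero
  card := h.card
  vanish t ht := by
    rcases Nat.lt_succ_iff_lt_or_eq.1 ht with h1 | h1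
    · exact h.vanish t h1
    · rwa [Fin.ext h1]
  span := h.span

theorem reduce {c : Fin n} (h : IsElimination B v d c W) (hB : B c c ≠ 0) :
    IsElimination B (fun t => v t - v c / B c c * B c t) d (c + 1) W where
  tri := h.tri
  zero := h.zero
  card := h.card
  vanish t ht := by
    rcases Nat.lt_succ_iff_lt_or_eq.1 ht with h1 | h1
    · rw [h.vanish t h1, h.tri c t h1, mul_zero, sub_zero]
    · rw [Fin.ext h1, div_mul_cancel₀ _ hB, sub_self]
  span := by
    have hsub : (fun t => v t - v c / B c c * B c t) = v - (v c / B c c) • B c := rfl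
    rw [hsub, ← h.span]
    have hc : B c ∈ Submodule.span F (Set.range B) := Submodule.subset_span ⟨c, rfl⟩
    refine le_antisymm (sup_le le_sup_left ?_) (sup_le le_sup_left ?_) <;>
      rw [Submodule.span_singleton_le_iff_mem]
    · exact Submodule.sub_mem _ (Submodule.mem_sup_right (Submodule.mem_span_singleton_self v))
        (Submodule.mem_sup_left (Submodule.smul_mem _ _ hc))
    · have hv := sub_add_cancel v ((v c / B c c) • B c)
      have h1 := Submodule.add_mem _
        (Submodule.mem_sup_right (S := Submodule.span F (Set.range B))
          (Submodule.mem_span_singleton_self (v - (v c / B c c) • B c)))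
        (Submodule.mem_sup_left (Submodule.smul_mem _ (v c / B c c) hc))
      rwa [hv] at h1

theorem insert {c : Fin n} (h : IsElimination B v d c W) (hv : v c ≠ 0) (hB : B c c = 0) :
    IsElimination (Function.update B c v) v (d + 1) c W where
  tri r t htr := by
    rcases eq_or_ne r c with rfl | hr
    · rw [Function.update_self]
      exact h.vanish t htr
    · rw [Function.update_of_ne hr]
      exact h.tri r t htr
  zero r hr0 := by
    rcases eq_or_ne r c with rfl | hr
    · rw [Function.update_self] at hr0
      exact absurd hr0 hv
    · rw [Function.update_of_ne hr] at hr0 ⊢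
      exact h.zero r hr0
  card := by
    have : {r | Function.update B c v r r ≠ 0} = Insert.insert c {r | B r r ≠ 0} := by
      ext r
      rcases eq_or_ne r c with rfl | hr
      · simp [hv]
      · simp [hr]
    rw [this, Set.ncard_insert_of_notMem (by simp [hB]), h.card]
  vanish := h.vanish
  span := by
    rw [← h.span]
    refine le_antisymm (sup_le ?_ le_sup_right) (sup_le ?_ le_sup_right) <;>
      rw [Submodule.span_le] <;> rintro _ ⟨r, rfl⟩
    · rcases eq_or_ne r c with rfl | hr
      · rw [Function.update_self]
        exact Submodule.mem_sup_right (Submodule.mem_span_singleton_self v)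
      · rw [Function.update_of_ne hr]
        exact Submodule.mem_sup_left (Submodule.subset_span ⟨r, rfl⟩)
    · rcases eq_or_ne r c with rfl | hr
      · rw [h.zero r hB]
        exact Submodule.zero_mem _
      · exact Submodule.mem_sup_left
          (Submodule.subset_span ⟨r, Function.update_of_ne hr _ _⟩)

/-- The nonzero rows are linearly independent: with unit vectors in place of the zero rows, they
form a triangular matrix with nonzero diagonal. -/
theorem finrank_eq (h : IsElimination B v d n W) : Module.finrank F W = d := by
  classical
  let M : Matrix (Fin n) (Fin n) F := fun r => if B r r = 0 then Pi.single r 1 else B r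
  have hMtri : M.BlockTriangular id := by
    intro r t htr
    simp only [M]
    split_ifs with h0
    · exact Pi.single_eq_of_ne (ne_of_lt htr) _
    · exact h.tri r t htr
  have hdet : IsUnit M := by
    rw [Matrix.isUnit_iff_isUnit_det, Matrix.det_of_isUpperTriangular hMtri, isUnit_iff_ne_zero,
      Finset.prod_ne_zero_iff]
    intro r _
    simp only [M]
    split_ifs with h0
    · simp
    · exact h0
  have hli : LinearIndependent F fun r : {r // B r r ≠ 0} => B r := by
    have h1 := (Matrix.linearIndependent_rows_iff_isUnit.2 hdet).comp
      (Subtype.val : {r // B r r ≠ 0} → Fin n) Subtype.val_injective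
    convert h1 using 1
    funext r
    simp [M, Matrix.row, r.2]
  have hspan : W = Submodule.span F (Set.range fun r : {r // B r r ≠ 0} => B r) := by
    rw [← h.span, h.eq_zero, Submodule.span_zero_singleton, sup_bot_eq]
    refine le_antisymm ?_ ?_ <;> rw [Submodule.span_le] <;> rintro _ ⟨r, rfl⟩
    · by_cases h0 : B r r = 0
      · rw [h.zero r h0]
        exact Submodule.zero_mem _
      · exact Submodule.subset_span ⟨⟨r, h0⟩, rfl⟩
    · exact Submodule.subset_span ⟨r, rfl⟩
  rw [hspan, finrank_span_eq_card hli, h.card, ← Nat.card_coe_set_eq, Nat.card_eq_fintype_card]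
  exact Fintype.card_congr (Equiv.refl _)

end IsElimination

/-- The square of the code generated by `G` is spanned by the products of two rows. -/
theorem squareCode_rowCode {F : Type*} [Field F] {k n : ℕ} (G : Matrix (Fin k) (Fin n) F) :
    squareCode (rowCode G) =
      Submodule.span F (Set.range fun p : Fin k × Fin k => fun t => G p.1 t * G p.2 t) := by
  have h1 : squareCode (rowCode G) = rowCode G * rowCode G := by
    rw [Submodule.mul_eq_span_mul_set, squareCode]
    congr 1
    ext x
    rw [Set.mem_mul]
    constructor
    · rintro ⟨c, hc, d, hd, rfl⟩
      exact ⟨c, hc, d, hd, rfl⟩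
    · rintro ⟨c, hc, d, hd, rfl⟩
      exact ⟨c, hc, d, hd, rfl⟩
  rw [h1, rowCode, Submodule.span_mul_span]
  congr 1
  ext x
  rw [Set.mem_mul]
  constructor
  · rintro ⟨_, ⟨i, rfl⟩, _, ⟨j, rfl⟩, rfl⟩
    exact ⟨(i, j), rfl⟩
  · rintro ⟨p, rfl⟩
    exact ⟨_, ⟨p.1, rfl⟩, _, ⟨p.2, rfl⟩, rfl⟩

/-! ### Running time and invariants of programs -/

namespace Program

/-- Only the registers `0` and `1` serve as loop counts, and neither is ever written. -/
def InputLoops : Program → Prop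
  | seq p p' => InputLoops p ∧ InputLoops p'
  | reset r => 1 < r
  | incr r => 1 < r
  | copy r _ => 1 < r
  | ifZero _ p p' => InputLoops p ∧ InputLoops p'
  | ifLt _ _ p p' => InputLoops p ∧ InputLoops p'
  | loop r p => r ≤ 1 ∧ InputLoops p
  | _ => True

/-- The depth of nested loops. -/
def loopDepth : Program → ℕ
  | seq p p' => max (loopDepth p) (loopDepth p')
  | ifZero _ p p' => max (loopDepth p) (loopDepth p')
  | ifLt _ _ p p' => max (loopDepth p) (loopDepth p')
  | loop _ p => loopDepth p + 1
  | _ => 0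

/-- The length of the program text, where each loop counts twice: it costs a step on entry and one
for each iteration. -/
def textSize : Program → ℕ
  | seq p p' => textSize p + textSize p'
  | ifZero _ p p' => 1 + (textSize p + textSize p')
  | ifLt _ _ p p' => 1 + (textSize p + textSize p')
  | loop _ p => 2 + textSize p
  | _ => 1

variable {F : Type*} [Field F]

theorem InputLoops.exec_reg {p : Program} (hp : p.InputLoops) (s : MState F) {r : ℕ}
    (hr : r ≤ 1) : (exec p s).reg r = s.reg r := by
  induction p generalizing s with
  | seq p p' ih ih' => rw [exec, ih' hp.2, ih hp.1]
  | reset r' | incr r' | copy r' r'' =>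
    have : r ≠ r' := ne_of_lt (lt_of_le_of_lt hr hp)
    simp [exec, MState.setReg, this]
  | fzero x | fone x | fadd x y z | fsub x y z | fmul x y z | fdiv x y z =>
    simp [exec, MState.put]
  | ifZero x p p' ih ih' | ifLt r' r'' p p' ih ih' =>
    rw [exec]
    split_ifs
    · exact ih hp.1 s
    · exact ih' hp.2 s
  | loop r' p ih =>
    rw [exec]
    generalize s.reg r' = m
    induction m with
    | zero => rfl
    | succ m ihm => rw [Function.iterate_succ_apply', ih hp.2, ihm]

/-- A program text of loop depth `e`, all of whose loops have at most `N` iterations, takes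
`O (N ^ e)` steps. -/
theorem InputLoops.steps_le {p : Program} (hp : p.InputLoops) {N : ℕ} (hN : 0 < N)
    (s : MState F) (h0 : s.reg 0 ≤ N) (h1 : s.reg 1 ≤ N) :
    steps p s ≤ textSize p * N ^ loopDepth p := by
  have key : ∀ a b c d : ℕ, a * N ^ c + b * N ^ d ≤ (a + b) * N ^ max c d := by
    intro a b c d
    rw [add_mul]
    gcongr <;> first | exact hN | exact le_max_left _ _ | exact le_max_right _ _
  have hpow : ∀ e : ℕ, 1 ≤ N ^ e := fun e => Nat.one_le_pow _ _ hN
  induction p generalizing s with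
  | seq p p' ih ih' =>
    have h2 := ih hp.1 s h0 h1
    have h3 := ih' hp.2 (exec p s) (by rwa [hp.1.exec_reg s (by omega)])
      (by rwa [hp.1.exec_reg s (by omega)])
    simp only [steps, textSize, loopDepth]
    exact (add_le_add h2 h3).trans (key _ _ _ _)
  | reset _ | incr _ | copy _ _ | fzero _ | fone _ | fadd _ _ _ | fsub _ _ _ | fmul _ _ _
  | fdiv _ _ _ => simp [steps, textSize, loopDepth]
  | ifZero x p p' ih ih' | ifLt _ _ p p' ih ih' =>
    have h2 := ih hp.1 s h0 h1
    have h3 := ih' hp.2 s h0 h1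
    simp only [steps, textSize, loopDepth]
    have h4 := key (textSize p) (textSize p') (loopDepth p) (loopDepth p')
    have h5 := hpow (max (loopDepth p) (loopDepth p'))
    rw [add_mul 1, one_mul]
    split_ifs <;> omega
  | loop r p ih =>
    have hr : s.reg r ≤ N := by
      have : r = 0 ∨ r = 1 := by have := hp.1; omega
      rcases this with rfl | rfl <;> assumption
    have hit : ∀ i r, r ≤ 1 → ((exec p)^[i] s).reg r = s.reg r := by
      intro i r hr
      induction i with
      | zero => rfl
      | succ i ihi => rw [Function.iterate_succ_apply', hp.2.exec_reg _ hr, ihi]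
    have hsum : ∑ i ∈ Finset.range (s.reg r), (1 + steps p ((exec p)^[i] s)) ≤
        N * (1 + textSize p * N ^ loopDepth p) := by
      calc _ ≤ ∑ _i ∈ Finset.range (s.reg r), (1 + textSize p * N ^ loopDepth p) := by
            refine Finset.sum_le_sum fun i _ => Nat.add_le_add_left (ih hp.2 _ ?_ ?_) 1
            · rwa [hit i 0 (by omega)]
            · rwa [hit i 1 le_rfl]
        _ = s.reg r * (1 + textSize p * N ^ loopDepth p) := by
            rw [Finset.sum_const, Finset.card_range, smul_eq_mul]
        _ ≤ _ := Nat.mul_le_mul_right _ hr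
    simp only [steps, textSize, loopDepth]
    have h2 := hpow (loopDepth p + 1)
    have h3 : N ≤ N ^ (loopDepth p + 1) := Nat.le_self_pow (by omega) N
    have h4 : N * (1 + textSize p * N ^ loopDepth p) =
        N + textSize p * N ^ (loopDepth p + 1) := by ring
    rw [add_mul]
    omega

/-- Run `p` for all values of the register `x` from `0` to the value of the register `r`
(exclusive). -/
def forReg (r x : ℕ) (p : Program) : Program := seq (reset x) (loop r (seq p (incr x)))

/-- The invariant rule for `forReg`. -/
theorem exec_forReg_induction {r x : ℕ} (hrx : r ≠ x) (p : Program) (s : MState F)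
    (I : ℕ → MState F → Prop) (h0 : I 0 (s.setReg x 0))
    (hs : ∀ m s', m < s.reg r → I m s' →
      I (m + 1) ((exec p s').setReg x ((exec p s').reg x + 1))) :
    I (s.reg r) (exec (forReg r x p) s) := by
  have hr : (s.setReg x 0).reg r = s.reg r := by simp [MState.setReg, hrx]
  simp only [forReg, exec, hr]
  have : ∀ m ≤ s.reg r, I m ((fun s' => (exec p s').setReg x ((exec p s').reg x + 1))^[m]
      (s.setReg x 0)) := by
    intro m
    induction m with
    | zero => exact fun _ => h0
    | succ m ih =>
      intro hm
      rw [Function.iterate_succ_apply']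
      exact hs m _ (by omega) (ih (by omega))
  exact this _ le_rfl

end Program

/-! ### The distinguisher -/

namespace SquareProgram

open Program

/-! Register `0` holds `n`, register `1` holds `k`, register `2` holds `l`, registers `3` and `4`
run over pairs of rows, register `5` over pivot columns, and register `6` over the columns in the
innermost loops. Register `7` is always `0`, register `8` counts the pivots, and register `10`
receives `2 * k - 1`. Array `0` holds the matrix, array `1` the echelon rows, row `0` of array `2`
the vector that is being reduced, arrays `3` and `5` scalars, and array `4` the constant `0`. -/

/-- Do nothing. -/
def nop : Program := copy 7 7

/-- Load the product of the rows numbered by registers `3` and `4`. -/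
def loadProduct : Program := forReg 0 6 (fmul ⟨2, 7, 6⟩ ⟨0, 3, 6⟩ ⟨0, 4, 6⟩)

/-- Store the current vector as the echelon row with pivot in the current column. -/
def storeRow : Program := seq (incr 8) (forReg 0 6 (fadd ⟨1, 5, 6⟩ ⟨2, 7, 6⟩ ⟨4, 7, 7⟩))

/-- Clear the current column of the current vector with the echelon row that has its pivot
there. -/
def clearColumn : Program :=
  seq (fdiv ⟨3, 7, 7⟩ ⟨2, 7, 5⟩ ⟨1, 5, 5⟩)
    (forReg 0 6 (seq (fmul ⟨5, 7, 7⟩ ⟨3, 7, 7⟩ ⟨1, 5, 6⟩)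
      (fsub ⟨2, 7, 6⟩ ⟨2, 7, 6⟩ ⟨5, 7, 7⟩)))

/-- One step of the elimination, in the current column. -/
def eliminateColumn : Program :=
  ifZero ⟨2, 7, 5⟩ nop (seq (ifZero ⟨1, 5, 5⟩ storeRow nop) clearColumn)

/-- Gaussian elimination, one vector after another, of all products of two rows. -/
def eliminateProducts : Program :=
  forReg 1 3 (forReg 1 4 (seq loadProduct (forReg 0 5 eliminateColumn)))

/-- Write `2 * k - 1` into register `10`. -/
def twoMulSubOne : Program :=
  seq (reset 9) (loop 1 (seq (incr 9) (seq (copy 10 9) (incr 9))))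

/-- Output the number of pivots, and compare it with the minimum of `l` and `2 * k - 1`. -/
def verdict : Program :=
  seq (copy 1 8) (seq (ifLt 2 10 (copy 10 2) nop)
    (ifLt 10 8 (reset 0) (ifLt 8 10 (reset 0) (seq (reset 0) (incr 0)))))

/-- The square-code distinguisher. -/
def distinguisher : Program := seq (seq eliminateProducts twoMulSubOne) verdict

variable {F : Type*} [Field F]

/-- The part of the state that does not change before the verdict. -/
structure Ctx (n k l : ℕ) (G : ℕ → ℕ → F) (s : MState F) : Prop where
  n : s.reg 0 = n
  k : s.reg 1 = k
  l : s.reg 2 = l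
  zero : s.reg 7 = 0
  mat : s.mem 0 = G
  fzero : s.mem 4 0 0 = 0

/-- The echelon rows. -/
def rows (n : ℕ) (s : MState F) : Fin n → Fin n → F := fun r t => s.mem 1 r t

/-- The vector that is being reduced. -/
def vec (n : ℕ) (s : MState F) : Fin n → F := fun t => s.mem 2 0 t

/-- The product of rows `p.1` and `p.2` of the matrix in memory. -/
def rowProduct (n : ℕ) (G : ℕ → ℕ → F) (p : ℕ × ℕ) : Fin n → F := fun t => G p.1 t * G p.2 t

variable {n k l : ℕ} {G : ℕ → ℕ → F} {s : MState F}

theorem Ctx.congr (h : Ctx n k l G s) {s' : MState F}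
    (hr : ∀ r, r ≤ 2 ∨ r = 7 → s'.reg r = s.reg r) (h0 : s'.mem 0 = s.mem 0)
    (h4 : s'.mem 4 = s.mem 4) : Ctx n k l G s' where
  n := (hr 0 (by norm_num)).trans h.n
  k := (hr 1 (by norm_num)).trans h.k
  l := (hr 2 (by norm_num)).trans h.l
  zero := (hr 7 (by norm_num)).trans h.zero
  mat := h0.trans h.mat
  fzero := h4 ▸ h.fzero

@[simp] theorem exec_nop (s : MState F) : exec nop s = s := by
  simp [nop, exec, MState.setReg]

theorem exec_loadProduct (h : Ctx n k l G s) :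
    (∀ r ≠ 6, (exec loadProduct s).reg r = s.reg r) ∧
    (∀ a ≠ 2, (exec loadProduct s).mem a = s.mem a) ∧
    vec n (exec loadProduct s) = rowProduct n G (s.reg 3, s.reg 4) := by
  have key := exec_forReg_induction (r := 0) (x := 6) (by norm_num)
    (fmul ⟨2, 7, 6⟩ ⟨0, 3, 6⟩ ⟨0, 4, 6⟩) s
    (fun m s' => (∀ r ≠ 6, s'.reg r = s.reg r) ∧ s'.reg 6 = m ∧ (∀ a ≠ 2, s'.mem a = s.mem a) ∧
      ∀ t < m, s'.mem 2 0 t = G (s.reg 3) t * G (s.reg 4) t) ?_ ?_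
  · obtain ⟨h1, -, h3, h4⟩ := key
    exact ⟨h1, h3, funext fun t => h4 t (h.n.symm ▸ t.2)⟩
  · refine ⟨fun r hr => by simp [MState.setReg, hr], by simp [MState.setReg],
      fun a _ => rfl, fun t ht => absurd ht (Nat.not_lt_zero _)⟩
  · rintro m s' - ⟨h1, h2, h3, h4⟩
    refine ⟨fun r hr => ?_, ?_, fun a ha => ?_, fun t ht => ?_⟩
    · simp [exec, MState.setReg, MState.put, hr, h1]
    · simp [exec, MState.setReg, MState.put, h2]
    · simp [exec, MState.setReg, MState.put, ha, h3]
    · have h7 := (h1 7 (by norm_num)).trans h.zero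
      simp only [exec, MState.setReg, MState.put, MState.get, h7, h2, true_and]
      split_ifs with htm
      · rw [htm, h3 0 (by norm_num), h.mat, h1 3 (by norm_num), h1 4 (by norm_num)]
      · exact h4 t (by omega)

theorem exec_storeRow (h : Ctx n k l G s) :
    (∀ r, r ≠ 6 → r ≠ 8 → (exec storeRow s).reg r = s.reg r) ∧
    (exec storeRow s).reg 8 = s.reg 8 + 1 ∧
    (∀ a ≠ 1, (exec storeRow s).mem a = s.mem a) ∧
    ∀ i, ∀ t < n, (exec storeRow s).mem 1 i t =
      if i = s.reg 5 then s.mem 2 0 t else s.mem 1 i t := by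
  have key := exec_forReg_induction (r := 0) (x := 6) (by norm_num)
    (fadd ⟨1, 5, 6⟩ ⟨2, 7, 6⟩ ⟨4, 7, 7⟩) (s.setReg 8 (s.reg 8 + 1))
    (fun m s' => (∀ r, r ≠ 6 → r ≠ 8 → s'.reg r = s.reg r) ∧ s'.reg 8 = s.reg 8 + 1 ∧
      s'.reg 6 = m ∧ (∀ a ≠ 1, s'.mem a = s.mem a) ∧
      ∀ i t, s'.mem 1 i t = if i = s.reg 5 ∧ t < m then s.mem 2 0 t else s.mem 1 i t) ?_ ?_
  · have hn : (s.setReg 8 (s.reg 8 + 1)).reg 0 = n := by simp [MState.setReg, h.n]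
    rw [hn] at key
    obtain ⟨h1, h8, -, h3, h4⟩ := key
    refine ⟨h1, h8, h3, fun i t ht => ?_⟩
    have := h4 i t
    simp only [ht, and_true] at this
    exact this
  · refine ⟨fun r hr hr' => by simp [MState.setReg, hr, hr'], by simp [MState.setReg],
      by simp [MState.setReg], fun a _ => rfl, fun i t => by simp [MState.setReg]⟩
  · rintro m s' - ⟨h1, h8, h2, h3, h4⟩
    refine ⟨fun r hr hr' => ?_, ?_, ?_, fun a ha => ?_, fun i t => ?_⟩
    · simp [exec, MState.setReg, MState.put, hr, h1 r hr hr']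
    · simp [exec, MState.setReg, MState.put, h8]
    · simp [exec, MState.setReg, MState.put, h2]
    · simp [exec, MState.setReg, MState.put, ha, h3]
    · have h7 := (h1 7 (by norm_num) (by norm_num)).trans h.zero
      have h5 := h1 5 (by norm_num) (by norm_num)
      simp only [exec, MState.setReg, MState.put, MState.get, h7, h2, h5, true_and,
        h3 2 (by norm_num), h3 4 (by norm_num), h.fzero, add_zero, h4]
      grind

theorem exec_clearColumn (h : Ctx n k l G s) :
    (∀ r ≠ 6, (exec clearColumn s).reg r = s.reg r) ∧
    (∀ a, a ≠ 2 → a ≠ 3 → a ≠ 5 → (exec clearColumn s).mem a = s.mem a) ∧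
    ∀ t < n, (exec clearColumn s).mem 2 0 t = s.mem 2 0 t -
      s.mem 2 0 (s.reg 5) / s.mem 1 (s.reg 5) (s.reg 5) * s.mem 1 (s.reg 5) t := by
  set q := s.mem 2 0 (s.reg 5) / s.mem 1 (s.reg 5) (s.reg 5) with hq
  have key := exec_forReg_induction (r := 0) (x := 6) (by norm_num)
    (seq (fmul ⟨5, 7, 7⟩ ⟨3, 7, 7⟩ ⟨1, 5, 6⟩) (fsub ⟨2, 7, 6⟩ ⟨2, 7, 6⟩ ⟨5, 7, 7⟩))
    (exec (fdiv ⟨3, 7, 7⟩ ⟨2, 7, 5⟩ ⟨1, 5, 5⟩) s)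
    (fun m s' => (∀ r ≠ 6, s'.reg r = s.reg r) ∧ s'.reg 6 = m ∧
      (∀ a, a ≠ 2 → a ≠ 3 → a ≠ 5 → s'.mem a = s.mem a) ∧ s'.mem 3 0 0 = q ∧
      ∀ t, s'.mem 2 0 t = if t < m then s.mem 2 0 t - q * s.mem 1 (s.reg 5) t
        else s.mem 2 0 t) ?_ ?_
  · have hn : (exec (fdiv ⟨3, 7, 7⟩ ⟨2, 7, 5⟩ ⟨1, 5, 5⟩) s).reg 0 = n := h.n
    rw [hn] at key
    obtain ⟨h1, -, h3, -, h4⟩ := key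
    refine ⟨h1, h3, fun t ht => ?_⟩
    have := h4 t
    rw [if_pos ht] at this
    exact this
  · refine ⟨fun r hr => by simp [exec, MState.put, MState.setReg, hr], by simp [MState.setReg],
      fun a _ ha _ => by simp [exec, MState.put, MState.setReg, ha], ?_,
      fun t => by simp [exec, MState.put, MState.setReg]⟩
    simp [exec, MState.put, MState.setReg, MState.get, h.zero, hq]
  · rintro m s' - ⟨h1, h2, h3, hq', h4⟩
    have h7 := (h1 7 (by norm_num)).trans h.zero
    have h5 := h1 5 (by norm_num)
    refine ⟨fun r hr => ?_, ?_, fun a ha ha' ha'' => ?_, ?_, fun t => ?_⟩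
    · simp [exec, MState.setReg, MState.put, hr, h1]
    · simp [exec, MState.setReg, MState.put, h2]
    · simp [exec, MState.setReg, MState.put, ha, ha'', h3 a ha ha' ha'']
    · simp [exec, MState.setReg, MState.put, hq']
    · simp only [exec, MState.setReg, MState.put, MState.get, h7, h2, h5, true_and, and_self,
        h3 1 (by norm_num) (by norm_num) (by norm_num), hq', h4, if_true]
      grind

/-- The state between two columns of the elimination. -/
def Elim (n c : ℕ) (W : Submodule F (Fin n → F)) (s : MState F) : Prop :=
  IsElimination (rows n s) (vec n s) (s.reg 8) c W

theorem exec_eliminateColumn (h : Ctx n k l G s) {W : Submodule F (Fin n → F)} {c : ℕ}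
    (hc : c < n) (h5 : s.reg 5 = c) (hE : Elim n c W s) :
    Ctx n k l G (exec eliminateColumn s) ∧ Elim n (c + 1) W (exec eliminateColumn s) ∧
    ∀ r, r ≠ 6 → r ≠ 8 → (exec eliminateColumn s).reg r = s.reg r := by
  -- clearing, for any state in which there is a pivot in column `c`
  have clear : ∀ s' : MState F, Ctx n k l G s' → s'.reg 5 = c → Elim n c W s' →
      s'.mem 1 c c ≠ 0 → Ctx n k l G (exec clearColumn s') ∧
        Elim n (c + 1) W (exec clearColumn s') ∧
        ∀ r ≠ 6, (exec clearColumn s').reg r = s'.reg r := by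
    intro s' h' h5' hE' hp
    obtain ⟨h1, h2, h3⟩ := exec_clearColumn h'
    refine ⟨h'.congr (fun r hr => h1 r (by omega)) (h2 0 (by norm_num) (by norm_num) (by norm_num))
      (h2 4 (by norm_num) (by norm_num) (by norm_num)), ?_, h1⟩
    have := IsElimination.reduce (c := ⟨c, hc⟩) hE' hp
    unfold Elim
    convert this using 1
    · unfold rows
      rw [h2 1 (by norm_num) (by norm_num) (by norm_num)]
    · funext t
      have := h3 t t.2
      rw [h5'] at this
      exact this
    · exact h1 8 (by norm_num)
  have hget : s.get ⟨2, 7, 5⟩ = s.mem 2 0 c := by simp [MState.get, h.zero, h5]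
  have hget' : s.get ⟨1, 5, 5⟩ = s.mem 1 c c := by simp [MState.get, h5]
  by_cases hv : s.mem 2 0 c = 0
  · have hex : exec eliminateColumn s = s := by
      simp [eliminateColumn, exec, hget, hv]
    rw [hex]
    exact ⟨h, IsElimination.skip (c := ⟨c, hc⟩) hE hv, fun _ _ _ => rfl⟩
  by_cases hp : s.mem 1 c c = 0
  · have hex : exec eliminateColumn s = exec clearColumn (exec storeRow s) := by
      simp [eliminateColumn, exec, hget, hget', hv, hp]
    obtain ⟨h1, h2, h3, h4⟩ := exec_storeRow h
    have hctx : Ctx n k l G (exec storeRow s) :=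
      h.congr (fun r hr => h1 r (by omega) (by omega)) (h3 0 (by norm_num)) (h3 4 (by norm_num))
    have hE' : Elim n c W (exec storeRow s) := by
      have := IsElimination.insert (c := ⟨c, hc⟩) hE hv hp
      unfold Elim
      convert this using 1
      · funext r t
        rw [Function.update_apply]
        have h6 := h4 r t t.2
        rw [h5] at h6
        simp only [rows, h6, Fin.ext_iff]
        split_ifs <;> rfl
      · unfold vec
        rw [h3 2 (by norm_num)]
    have hp' : (exec storeRow s).mem 1 c c ≠ 0 := by
      rw [h4 c c hc, if_pos h5.symm]
      exact hv
    obtain ⟨c1, c2, c3⟩ := clear _ hctx ((h1 5 (by norm_num) (by norm_num)).trans h5) hE' hp'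
    rw [hex]
    exact ⟨c1, c2, fun r hr hr' => (c3 r hr).trans (h1 r hr hr')⟩
  · have hex : exec eliminateColumn s = exec clearColumn s := by
      simp [eliminateColumn, exec, hget, hget', hv, hp]
    obtain ⟨c1, c2, c3⟩ := clear s h h5 hE hp
    rw [hex]
    exact ⟨c1, c2, fun r hr _ => c3 r hr⟩

/-- Eliminating one product adds it to the span. -/
theorem exec_eliminateProduct (h : Ctx n k l G s) {W : Submodule F (Fin n → F)}
    (hE : Elim n n W s) :
    Ctx n k l G (exec (seq loadProduct (forReg 0 5 eliminateColumn)) s) ∧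
    Elim n n (W ⊔ Submodule.span F {rowProduct n G (s.reg 3, s.reg 4)})
      (exec (seq loadProduct (forReg 0 5 eliminateColumn)) s) ∧
    (exec (seq loadProduct (forReg 0 5 eliminateColumn)) s).reg 3 = s.reg 3 ∧
    (exec (seq loadProduct (forReg 0 5 eliminateColumn)) s).reg 4 = s.reg 4 := by
  obtain ⟨h1, h2, h3⟩ := exec_loadProduct h
  set s₁ := exec loadProduct s with hs₁
  have hctx : Ctx n k l G s₁ :=
    h.congr (fun r hr => h1 r (by omega)) (h2 0 (by norm_num)) (h2 4 (by norm_num))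
  have hE₁ : Elim n 0 (W ⊔ Submodule.span F {rowProduct n G (s.reg 3, s.reg 4)}) s₁ := by
    have := IsElimination.load hE (rowProduct n G (s.reg 3, s.reg 4))
    unfold Elim
    convert this using 1
    · unfold rows
      rw [h2 1 (by norm_num)]
    · exact h1 8 (by norm_num)
  have key := exec_forReg_induction (r := 0) (x := 5) (by norm_num) eliminateColumn s₁
    (fun m s' => Ctx n k l G s' ∧ s'.reg 5 = m ∧
      Elim n m (W ⊔ Submodule.span F {rowProduct n G (s.reg 3, s.reg 4)}) s' ∧
      s'.reg 3 = s.reg 3 ∧ s'.reg 4 = s.reg 4) ?_ ?_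
  · rw [hctx.n] at key
    exact ⟨key.1, key.2.2⟩
  · refine ⟨hctx.congr (fun r hr => ?_) rfl rfl, ?_, hE₁, ?_, ?_⟩
    · have : r ≠ 5 := by omega
      simp [MState.setReg, this]
    · simp [MState.setReg]
    · simp [MState.setReg, h1]
    · simp [MState.setReg, h1]
  · rintro m s' hm ⟨hc', h5, hE', h3', h4'⟩
    rw [hctx.n] at hm
    obtain ⟨e1, e2, e3⟩ := exec_eliminateColumn hc' hm h5 hE'
    refine ⟨e1.congr (fun r hr => ?_) rfl rfl, ?_, e2, ?_, ?_⟩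
    · have : r ≠ 5 := by omega
      simp [MState.setReg, this]
    · simp [MState.setReg, e3 5, h5]
    · simp [MState.setReg, e3 3, h3']
    · simp [MState.setReg, e3 4, h4']

/-- The pairs of row numbers less than `k` that precede `(i, j)` in lexicographic order. -/
def pairsBefore (k i j : ℕ) : Set (ℕ × ℕ) := {p | p.1 < i ∧ p.2 < k ∨ p.1 = i ∧ p.2 < j}

theorem pairsBefore_succ (k i j : ℕ) :
    pairsBefore k i (j + 1) = insert (i, j) (pairsBefore k i j) := by
  ext ⟨a, b⟩
  simp only [pairsBefore, Set.mem_ofPred_eq, Set.mem_insert_iff, Prod.mk.injEq]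
  omega

theorem pairsBefore_self (k i : ℕ) : pairsBefore k i k = pairsBefore k (i + 1) 0 := by
  ext ⟨a, b⟩
  simp only [pairsBefore, Set.mem_ofPred_eq]
  omega

theorem exec_eliminateProducts (h : Ctx n k l G s) (hE : Elim n n ⊥ s) :
    Ctx n k l G (exec eliminateProducts s) ∧
    Elim n n (Submodule.span F (rowProduct n G '' pairsBefore k k 0))
      (exec eliminateProducts s) := by
  have inner : ∀ i s', Ctx n k l G s' → s'.reg 3 = i →
      Elim n n (Submodule.span F (rowProduct n G '' pairsBefore k i 0)) s' →
      Ctx n k l G (exec (forReg 1 4 (seq loadProduct (forReg 0 5 eliminateColumn))) s') ∧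
      (exec (forReg 1 4 (seq loadProduct (forReg 0 5 eliminateColumn))) s').reg 3 = i ∧
      Elim n n (Submodule.span F (rowProduct n G '' pairsBefore k (i + 1) 0))
        (exec (forReg 1 4 (seq loadProduct (forReg 0 5 eliminateColumn))) s') := by
    intro i s' hc h3 hE'
    have key := exec_forReg_induction (r := 1) (x := 4) (by norm_num)
      (seq loadProduct (forReg 0 5 eliminateColumn)) s'
      (fun j s' => Ctx n k l G s' ∧ s'.reg 4 = j ∧ s'.reg 3 = i ∧
        Elim n n (Submodule.span F (rowProduct n G '' pairsBefore k i j)) s') ?_ ?_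
    · rw [hc.k, pairsBefore_self] at key
      exact ⟨key.1, key.2.2⟩
    · refine ⟨hc.congr (fun r hr => ?_) rfl rfl, ?_, ?_, hE'⟩
      · have : r ≠ 4 := by omega
        simp [MState.setReg, this]
      · simp [MState.setReg]
      · simp [MState.setReg, h3]
    · rintro j t - ⟨hc, h4, h3, hE'⟩
      obtain ⟨e1, e2, e3, e4⟩ := exec_eliminateProduct hc hE'
      refine ⟨e1.congr (fun r hr => ?_) rfl rfl, ?_, ?_, ?_⟩
      · have : r ≠ 4 := by omega
        simp [MState.setReg, this]
      · simp [MState.setReg, e4, h4]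
      · simp [MState.setReg, e3, h3]
      · rw [pairsBefore_succ, Set.image_insert_eq, Submodule.span_insert, sup_comm]
        rw [h3, h4] at e2
        exact e2
  have key := exec_forReg_induction (r := 1) (x := 3) (by norm_num)
    (forReg 1 4 (seq loadProduct (forReg 0 5 eliminateColumn))) s
    (fun i s' => Ctx n k l G s' ∧ s'.reg 3 = i ∧
      Elim n n (Submodule.span F (rowProduct n G '' pairsBefore k i 0)) s') ?_ ?_
  · rw [h.k] at key
    exact ⟨key.1, key.2.2⟩
  · refine ⟨h.congr (fun r hr => ?_) rfl rfl, ?_, ?_⟩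
    · have : r ≠ 3 := by omega
      simp [MState.setReg, this]
    · simp [MState.setReg]
    · have : pairsBefore k 0 0 = ∅ := by
        ext ⟨a, b⟩
        simp [pairsBefore]
      rw [this, Set.image_empty, Submodule.span_empty]
      exact hE
  · rintro i s' - ⟨hc, h3, hE'⟩
    obtain ⟨e1, e2, e3⟩ := inner i s' hc h3 hE'
    refine ⟨e1.congr (fun r hr => ?_) rfl rfl, ?_, e3⟩
    · have : r ≠ 3 := by omega
      simp [MState.setReg, this]
    · simp [MState.setReg, e2]

theorem exec_twoMulSubOne (s : MState F) (hk : 0 < s.reg 1) :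
    (∀ r, r ≠ 9 → r ≠ 10 → (exec twoMulSubOne s).reg r = s.reg r) ∧
    (exec twoMulSubOne s).reg 10 = 2 * s.reg 1 - 1 := by
  have hr : (s.setReg 9 0).reg 1 = s.reg 1 := by simp [MState.setReg]
  have key : ∀ m, ∀ s' : MState F,
      s' = (exec (seq (incr 9) (seq (copy 10 9) (incr 9))))^[m] (s.setReg 9 0) →
      (∀ r, r ≠ 9 → r ≠ 10 → s'.reg r = s.reg r) ∧ s'.reg 9 = 2 * m ∧
        (0 < m → s'.reg 10 = 2 * m - 1) := by
    intro m
    induction m with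
    | zero =>
      rintro _ rfl
      refine ⟨fun r h9 _ => by simp [MState.setReg, h9], by simp [MState.setReg], by simp⟩
    | succ m ih =>
      rintro _ rfl
      obtain ⟨h1, h2, -⟩ := ih _ rfl
      rw [Function.iterate_succ_apply']
      generalize (exec (seq (incr 9) (seq (copy 10 9) (incr 9))))^[m] (s.setReg 9 0) = t at h1 h2
      refine ⟨fun r h9 h10 => ?_, ?_, fun _ => ?_⟩
      · rw [← h1 r h9 h10]
        simp [exec, MState.setReg, h9, h10]
      · simp [exec, MState.setReg, h2]
        ring
      · simp [exec, MState.setReg, h2]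
        omega
  simp only [twoMulSubOne, exec, hr]
  obtain ⟨h1, -, h3⟩ := key _ _ rfl
  exact ⟨h1, h3 hk⟩

/-- The declaration is read from register `0`: the two comparisons exclude both strict
inequalities between the dimension and the minimum. -/
theorem exec_verdict (s : MState F) :
    (exec verdict s).reg 1 = s.reg 8 ∧
    ((exec verdict s).reg 0 = 1 ↔ s.reg 8 = min (s.reg 2) (s.reg 10)) := by
  obtain ⟨t, ht, h1, h8, h10⟩ : ∃ t, t = exec (ifLt 2 10 (copy 10 2) nop) (exec (copy 1 8) s) ∧
      t.reg 1 = s.reg 8 ∧ t.reg 8 = s.reg 8 ∧ t.reg 10 = min (s.reg 2) (s.reg 10) := by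
    refine ⟨_, rfl, ?_⟩
    simp only [exec, exec_nop]
    split_ifs with h <;> simp [MState.setReg] at h ⊢ <;> omega
  rw [verdict, exec, exec, ← ht]
  simp only [exec]
  split_ifs with h h' <;> simp [MState.setReg, h1] <;> omega

theorem steps_verdict_le (s : MState F) : steps verdict s ≤ 8 := by
  simp only [verdict, steps, nop]
  split_ifs <;> norm_num

/-- The distinguisher outputs the dimension of the square code and decides correctly. -/
theorem exec_distinguisher {k n : ℕ} (hk : 0 < k) (l : ℕ) (G : Matrix (Fin k) (Fin n) F) :
    outputDim distinguisher l G = Module.finrank F (squareCode (rowCode G)) ∧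
    (DeclaresGLRS distinguisher l G ↔
      Module.finrank F (squareCode (rowCode G)) = min l (2 * k - 1)) := by
  set s := inputState l G with hs
  have hctx : Ctx n k l (s.mem 0) s := by
    refine ⟨rfl, rfl, rfl, rfl, rfl, ?_⟩
    simp [hs, inputState]
  have hE : Elim n n ⊥ s := by
    have := IsElimination.init (F := F) (n := n)
    unfold Elim
    convert this using 1
    · funext r t
      simp [rows, hs, inputState]
    · funext t
      simp [vec, hs, inputState]
    · simp [hs, inputState]
  obtain ⟨h1, h2⟩ := exec_eliminateProducts hctx hE
  have hW : Submodule.span F (rowProduct n (s.mem 0) '' pairsBefore k k 0) =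
      squareCode (rowCode G) := by
    rw [squareCode_rowCode]
    congr 1
    have hmem : ∀ (i : Fin k) (t : Fin n), s.mem 0 i t = G i t := fun i t => by
      simp [hs, inputState]
    ext x
    constructor
    · rintro ⟨⟨a, b⟩, hp, rfl⟩
      have hp : a < k ∧ b < k := by
        simp only [pairsBefore, Set.mem_ofPred_eq] at hp
        omega
      refine ⟨(⟨a, hp.1⟩, ⟨b, hp.2⟩), funext fun t => ?_⟩
      simp only [rowProduct, ← hmem]
    · rintro ⟨⟨a, b⟩, rfl⟩
      refine ⟨(a, b), Or.inl ⟨a.2, b.2⟩, funext fun t => ?_⟩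
      simp only [rowProduct, ← hmem]
  rw [hW] at h2
  have hdim := IsElimination.finrank_eq h2
  obtain ⟨t1, t2⟩ := exec_twoMulSubOne (exec eliminateProducts s) (by rw [h1.k]; exact hk)
  obtain ⟨v1, v2⟩ := exec_verdict (exec twoMulSubOne (exec eliminateProducts s))
  rw [t1 8 (by norm_num) (by norm_num), ← hdim] at v1 v2
  rw [t1 2 (by norm_num) (by norm_num), t2, h1.k, h1.l] at v2
  exact ⟨v1, v2⟩

theorem runningTime_distinguisher_le {k n : ℕ} (hk : k ≤ n) (hn : 0 < n) (l : ℕ)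
    (G : Matrix (Fin k) (Fin n) F) :
    runningTime distinguisher l G ≤
      (textSize (seq eliminateProducts twoMulSubOne) + 8) * n ^ 5 := by
  have hloops : InputLoops (seq eliminateProducts twoMulSubOne) := by
    simp [InputLoops, eliminateProducts, twoMulSubOne, forReg, loadProduct, eliminateColumn,
      storeRow, clearColumn, nop]
  have hdepth : loopDepth (seq eliminateProducts twoMulSubOne) ≤ 5 := by
    simp [loopDepth, eliminateProducts, twoMulSubOne, forReg, loadProduct, eliminateColumn,
      storeRow, clearColumn, nop]
  have h1 := hloops.steps_le hn (inputState l G) (by simp [inputState]) (by simpa [inputState])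
  have h2 := Nat.mul_le_mul_left (textSize (seq eliminateProducts twoMulSubOne))
    (Nat.pow_le_pow_right hn hdepth)
  have h3 := steps_verdict_le (exec (seq eliminateProducts twoMulSubOne) (inputState l G))
  have h4 : 1 ≤ n ^ 5 := Nat.one_le_pow _ _ hn
  rw [runningTime, distinguisher, steps, add_mul]
  omega

end SquareProgram

theorem mainTheorem5 :
    ∃ (P : Program) (A : ℕ),
      (∀ (Fq : Type*) (F : Type*) [Field Fq] [Finite Fq] [Field F] [Finite F] [Algebra Fq F]
          (n k : ℕ) (blk : Composition n), 2 < k → 2 * k ≤ n →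
        ∀ (C : Submodule F (Fin n → F)) (G : Matrix (Fin k) (Fin n) F), IsGeneratorMatrix G C →
          runningTime P blk.length G ≤ A * n ^ 5 ∧
          outputDim P blk.length G = Module.finrank F (squareCode C) ∧
          (DeclaresGLRS P blk.length G ↔
            Module.finrank F (squareCode C) = min blk.length (2 * k - 1)) ∧
          (∀ γ : F, IsGLRS (AlgEquiv.refl : F ≃ₐ[Fq] F) γ blk k C →
            DeclaresGLRS P blk.length G)) ∧
      (∀ ε : ℝ, 0 < ε → ∃ K : ℕ,
        ∀ (F : Type*) [Field F] [Finite F] (n k : ℕ) (blk : Composition n),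
          2 < k → 2 * k ≤ n → (K ≤ k ∨ K ≤ Nat.card F) →
            randomCodeProb k n
              {C : Submodule F (Fin n → F) | ∃ G : Matrix (Fin k) (Fin n) F,
                IsGeneratorMatrix G C ∧ DeclaresGLRS P blk.length G} ≤ ε) := by
  refine ⟨SquareProgram.distinguisher, Program.textSize (Program.seq
    SquareProgram.eliminateProducts SquareProgram.twoMulSubOne) + 8, ?_, fun ε hε => ?_⟩
  · intro Fq F _ _ _ _ _ n k blk hk hn C G hG
    obtain ⟨h1, h2⟩ := SquareProgram.exec_distinguisher (by omega) blk.length G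
    rw [hG.1] at h1 h2
    exact ⟨SquareProgram.runningTime_distinguisher_le (by omega) (by omega) blk.length G, h1, h2,
      fun γ hγ => h2.2 (hγ.finrank_squareCode (by omega))⟩
  · obtain ⟨K, hK⟩ := exists_randomCodeProb_finrank_squareCode_lt_le ε hε
    refine ⟨K, fun F _ _ n k blk hk hn hkK => (?_ : _ ≤ _).trans (hK F n k hk hn hkK)⟩
    unfold randomCodeProb
    refine div_le_div_of_nonneg_right ?_ (Nat.cast_nonneg _)
    refine Nat.cast_le.2 (Set.ncard_le_ncard ?_ (Set.toFinite _))
    rintro C ⟨hC, G, hG, hdecl⟩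
    refine ⟨hC, ?_⟩
    rw [(SquareProgram.exec_distinguisher (by omega) blk.length G).2, hG.1] at hdecl
    rw [Set.mem_ofPred_eq, hdecl]
    omega
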